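/- Let $\mathbb F,\mathbb K$ be $\mathbb R$ or $\mathbb C$ with $\mathbb F\subseteq\mathbb K$ (times are $\mathbb F$-valued, functions are $\mathbb K$-valued). For functions of $n\in\mathbb Z$ put $(\Lambda\varphi)(n)=\varphi(n+1)$, $\Delta=\Lambda-1$, and let $$W_p^\Delta(\varphi_1,\dots,\varphi_p)=\det\big(\Delta^{r}\varphi_c\big)_{0\le r\le p-1,\ 1\le c\le p}.$$ Pseudo-difference operators are formal series $\sum_{j\le N}a_j\Delta^j$ whose coefficients $a_j$ are functions of $n$, composed by the rule $\Delta\circ a=\Lambda(a)\,\Delta+\Delta(a)$; $A_+$ and $A_-$ denote the parts of $A$ with $j\ge 0$ and with $j<0$; and $\big(\sum_j b_j\Lambda^j\big)^*=\sum_j\Lambda^{-j}\circ b_j$ is the formal adjoint of a difference operator. Let $D$ be a set of times $t=(t_1,t_2,\dots)$ in which each single time can be varied in a neighbourhood (for example the set of all finitely supported sequences, or an open set). Let $m,M\ge 0$, $k\ge 1$, and let $f_1,\dots,f_m$ be functions of $(n,t)\in\mathbb Z\times D$, analytic in each time (if $\mathbb F=\mathbb C$ this follows from the equations below), with $$\frac{\partial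 f_i}{\partial t_l}=\Delta^l f_i\qquad(l=1,2,\dots)$$ and $\tau_\Delta=W_m^\Delta(f_1,\dots,f_m)\neq0$ everywhere on $\mathbb Z\times D$. Let $$T_m=\frac1{\tau_\Delta}\begin{vmatrix} f_1&\cdots&f_m&1\\ \Delta f_1&\cdots&\Delta f_m&\Delta\\ \vdots& &\vdots&\vdots\\ \Delta^m f_1&\cdots&\Delta^m f_m&\Delta^m\end{vmatrix}$$ (expanded along the last column, with the cofactors to the left of the powers of $\Delta$), and let $L=T_m\circ\Delta\circ T_m^{-1}$ be the Lax operator generated by $\tau_\Delta$. Then $L$ solves the discrete KP hierarchy $\partial L/\partial t_l=[B_l,L]$, $B_l=(L^l)_+$, $l=1,2,\dots$, and the following statements are equivalent: 1. $(L^k)_-=\sum_{i=1}^M q_i\,\Delta^{-1}r_i$ for some functions $q_1,\dots,q_M,r_1,\dots,r_M$ of $(n,t)\in\mathbb Z\times D$. 2. $(L^k)_-=\sum_{i=1}^M q_i\,\Delta^{-1}r_i$ for some functions $q_i,r_i$ of $(n,t)$ that are analytic in each time and satisfy $\partial q_i/\partial t_l=B_l(q_i)$ and $\partial r_i/\partial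 t_l=-B_l^*(r_i)$ for all $l\ge1$. 3. $W^\Delta_{m+M+1}(f_1,\dots,f_m,\Delta^kf_{i_1},\dots,\Delta^kf_{i_{M+1}})=0$ on $\mathbb Z\times D$ for all $1\le i_1<\dots<i_{M+1}\le m$. 4. $W^\Delta_{M+1}(h_{i_1},\dots,h_{i_{M+1}})=0$ on $\mathbb Z\times D$ for all $1\le i_1<\dots<i_{M+1}\le m$, where $h_i=\dfrac{W^\Delta_{m+1}(f_1,\dots,f_m,\Delta^kf_i)}{W^\Delta_m(f_1,\dots,f_m)}$. Moreover, for all $1\le i_1<\dots<i_{M+1}\le m$, $$W^\Delta_{m+M+1}(f_1,\dots,f_m,\Delta^kf_{i_1},\dots,\Delta^kf_{i_{M+1}})=W_m^\Delta(f_1,\dots,f_m)\;W^\Delta_{M+1}(h_{i_1},\dots,h_{i_{M+1}}).$$ -/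

import Mathlib

/-!
# Discrete KP hierarchy: pseudo-difference operators, Wronskians, Lax operators

Sequences `φ : ℤ → K` are functions of the discrete variable `n`.  `Λ` is the shift
`(Λ φ)(n) = φ (n + 1)` and `Δ = Λ - 1` is the forward difference (Mathlib's `fwdDiff 1`).
The times `t₁, t₂, …` are a point `t : ℕ+ → 𝕜`.
-/

open Filter Topology

noncomputable section

/-- Formal pseudo-difference operators in the discrete variable `n`, with sequences as coefficients:
`coeff j` is the coefficient (a function of `n`, written on the left) of `Λ ^ j`; only finitely many
positive powers occur.

Since `Δ = Λ - 1` and `Δ⁻¹ = Λ⁻¹ + Λ⁻² + ⋯`, the power `Δ ^ j` is `Λ ^ j` plus an integral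
combination of lower powers of `Λ`, and conversely; so the formal Laurent series in `Δ⁻¹` with
coefficients on the left are exactly the formal Laurent series in `Λ⁻¹`.  Moreover the span of the
`Δ ^ j` with `j ≥ 0` is the span of the `Λ ^ j` with `j ≥ 0`, and likewise for `j < 0`
(see `minus_ofSeq_mul_Delta_pow` and `plus_ofSeq_mul_DeltaInv_pow` below). -/
@[ext]
structure PseudoDiffOp (K : Type*) [Field K] where
  /-- `coeff j n` is the value at `n` of the coefficient of `Λ ^ j`. -/
  coeff : ℤ → ℤ → K
  bdd : ∃ N : ℤ, ∀ j, N < j → ∀ n, coeff j n = 0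

namespace PseudoDiffOp

variable {K : Type*} [Field K]

theorem mul_support {A B : PseudoDiffOp K} {a b : ℤ} (ha : ∀ j, a < j → ∀ n, A.coeff j n = 0)
    (hb : ∀ j, b < j → ∀ n, B.coeff j n = 0) (j n : ℤ) :
    ∑ᶠ i : ℤ, A.coeff i n * B.coeff (j - i) (n + i)
      = ∑ i ∈ Finset.Icc (j - b) a, A.coeff i n * B.coeff (j - i) (n + i) := by
  apply finsum_eq_sum_of_support_subset
  intro i hi
  simp only [Function.mem_support, ne_eq, mul_eq_zero, not_or] at hi
  simp only [Finset.coe_Icc, Set.mem_Icc]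
  constructor
  · by_contra h
    exact hi.2 (hb _ (by omega) _)
  · by_contra h
    exact hi.1 (ha _ (by omega) _)

instance : Zero (PseudoDiffOp K) := ⟨⟨fun _ _ => 0, 0, fun _ _ _ => rfl⟩⟩

instance : One (PseudoDiffOp K) :=
  ⟨⟨fun j _ => if j = 0 then 1 else 0, 0, fun j hj _ => if_neg (by omega)⟩⟩

instance : Add (PseudoDiffOp K) :=
  ⟨fun A B => ⟨fun j n => A.coeff j n + B.coeff j n, by
    obtain ⟨a, ha⟩ := A.bdd
    obtain ⟨b, hb⟩ := B.bdd
    refine ⟨max a b, fun j hj n => ?_⟩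
    rw [ha j (by omega), hb j (by omega), add_zero]⟩⟩

instance : Neg (PseudoDiffOp K) :=
  ⟨fun A => ⟨fun j n => -A.coeff j n, by
    obtain ⟨a, ha⟩ := A.bdd
    exact ⟨a, fun j hj n => by rw [ha j hj, neg_zero]⟩⟩⟩

/-- Composition of operators, determined by `Λ ^ i ∘ b = b (· + i) Λ ^ i`. -/
instance : Mul (PseudoDiffOp K) :=
  ⟨fun A B => ⟨fun j n => ∑ᶠ i : ℤ, A.coeff i n * B.coeff (j - i) (n + i), by
    obtain ⟨a, ha⟩ := A.bdd
    obtain ⟨b, hb⟩ := B.bdd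
    refine ⟨a + b, fun j hj n => ?_⟩
    rw [mul_support ha hb, Finset.Icc_eq_empty (by omega), Finset.sum_empty]⟩⟩

@[simp] theorem coeff_zero (j n : ℤ) : (0 : PseudoDiffOp K).coeff j n = 0 := rfl

theorem coeff_one (j n : ℤ) : (1 : PseudoDiffOp K).coeff j n = if j = 0 then 1 else 0 := rfl

@[simp] theorem coeff_add (A B : PseudoDiffOp K) (j n : ℤ) :
    (A + B).coeff j n = A.coeff j n + B.coeff j n := rfl

@[simp] theorem coeff_neg (A : PseudoDiffOp K) (j n : ℤ) :
    (-A).coeff j n = -A.coeff j n := rfl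

theorem coeff_mul (A B : PseudoDiffOp K) (j n : ℤ) :
    (A * B).coeff j n = ∑ᶠ i : ℤ, A.coeff i n * B.coeff (j - i) (n + i) := rfl

/-- The defining sum of the composition is finite; any bounds of the orders may be used. -/
theorem coeff_mul_eq {A B : PseudoDiffOp K} {a b : ℤ} (ha : ∀ j, a < j → ∀ n, A.coeff j n = 0)
    (hb : ∀ j, b < j → ∀ n, B.coeff j n = 0) (j n : ℤ) :
    (A * B).coeff j n
      = ∑ i ∈ Finset.Icc (j - b) a, A.coeff i n * B.coeff (j - i) (n + i) :=
  mul_support ha hb j n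

theorem mul_bound {A B : PseudoDiffOp K} {a b : ℤ} (ha : ∀ j, a < j → ∀ n, A.coeff j n = 0)
    (hb : ∀ j, b < j → ∀ n, B.coeff j n = 0) : ∀ j, a + b < j → ∀ n, (A * B).coeff j n = 0 := by
  intro j hj n
  rw [coeff_mul_eq ha hb, Finset.Icc_eq_empty (by omega), Finset.sum_empty]

theorem mul_assoc_aux (A B C : PseudoDiffOp K) : A * B * C = A * (B * C) := by
  obtain ⟨a, ha⟩ := A.bdd
  obtain ⟨b, hb⟩ := B.bdd
  obtain ⟨c, hc⟩ := C.bdd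
  ext j n
  rw [coeff_mul_eq (mul_bound ha hb) hc, coeff_mul_eq ha (mul_bound hb hc)]
  simp_rw [coeff_mul_eq ha hb, coeff_mul_eq hb hc, Finset.sum_mul, Finset.mul_sum]
  rw [Finset.sum_sigma', Finset.sum_sigma']
  refine Finset.sum_bij' (fun x _ => ⟨x.2, x.1 - x.2⟩) (fun x _ => ⟨x.1 + x.2, x.1⟩) ?_ ?_ ?_ ?_ ?_
  · rintro ⟨i, l⟩ h
    simp only [Finset.mem_sigma, Finset.mem_Icc] at h ⊢
    omega
  · rintro ⟨i, l⟩ h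
    simp only [Finset.mem_sigma, Finset.mem_Icc] at h ⊢
    omega
  · rintro ⟨i, l⟩ h
    simp
  · rintro ⟨i, l⟩ h
    simp
  · rintro ⟨i, l⟩ h
    have e1 : j - l - (i - l) = j - i := by ring
    have e2 : n + l + (i - l) = n + i := by ring
    simp only [e1, e2, mul_assoc]

/-- Pseudo-difference operators form a (noncommutative) ring under composition. -/
instance : Ring (PseudoDiffOp K) where
  add_assoc A B C := by ext j n; simp [add_assoc]
  zero_add A := by ext j n; simp
  add_zero A := by ext j n; simp
  add_comm A B := by ext j n; simp [add_comm]
  neg_add_cancel A := by ext j n; simp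
  nsmul := nsmulRec
  zsmul := zsmulRec
  mul_assoc := mul_assoc_aux
  one_mul A := by
    ext j n
    rw [coeff_mul, finsum_eq_single _ 0 (fun i hi => by simp [coeff_one, hi])]
    simp [coeff_one]
  mul_one A := by
    ext j n
    rw [coeff_mul, finsum_eq_single _ j (fun i hi => by
      rw [coeff_one, if_neg (by omega), mul_zero])]
    simp [coeff_one]
  zero_mul A := by ext j n; simp [coeff_mul]
  mul_zero A := by ext j n; simp [coeff_mul]
  left_distrib A B C := by
    obtain ⟨a, ha⟩ := A.bdd
    obtain ⟨b, hb⟩ := B.bdd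
    obtain ⟨c, hc⟩ := C.bdd
    ext j n
    rw [coeff_add, coeff_mul_eq (b := max b c) ha (fun i hi n => by
        rw [coeff_add, hb i (by omega), hc i (by omega), add_zero]),
      coeff_mul_eq (b := max b c) ha (fun i hi n => hb i (by omega) n),
      coeff_mul_eq (b := max b c) ha (fun i hi n => hc i (by omega) n), ← Finset.sum_add_distrib]
    simp [mul_add]
  right_distrib A B C := by
    obtain ⟨a, ha⟩ := A.bdd
    obtain ⟨b, hb⟩ := B.bdd
    obtain ⟨c, hc⟩ := C.bdd
    ext j n
    rw [coeff_add, coeff_mul_eq (a := max a b) (fun i hi n => by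
        rw [coeff_add, ha i (by omega), hb i (by omega), add_zero]) hc,
      coeff_mul_eq (a := max a b) (fun i hi n => ha i (by omega) n) hc,
      coeff_mul_eq (a := max a b) (fun i hi n => hb i (by omega) n) hc, ← Finset.sum_add_distrib]
    simp [add_mul]

/-- The operator of multiplication by a sequence. -/
def ofSeq (φ : ℤ → K) : PseudoDiffOp K :=
  ⟨fun j n => if j = 0 then φ n else 0, 0, fun j hj _ => if_neg (by omega)⟩

/-- The difference operator `Δ = Λ - 1`. -/
def Delta : PseudoDiffOp K :=
  ⟨fun j _ => if j = 1 then 1 else if j = 0 then -1 else 0, 1, fun j hj _ => by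
    rw [if_neg (by omega), if_neg (by omega)]⟩

/-- The formal inverse `Δ⁻¹ = Λ⁻¹ + Λ⁻² + Λ⁻³ + ⋯` of `Δ`. -/
def DeltaInv : PseudoDiffOp K :=
  ⟨fun j _ => if j ≤ -1 then 1 else 0, -1, fun j hj _ => if_neg (by omega)⟩

/-- The difference-operator part `A₊` (the nonnegative powers of `Δ`). -/
def plus (A : PseudoDiffOp K) : PseudoDiffOp K :=
  ⟨fun j n => if 0 ≤ j then A.coeff j n else 0, by
    obtain ⟨a, ha⟩ := A.bdd
    exact ⟨a, fun j hj n => by rw [ha j hj, ite_self]⟩⟩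

/-- The part `A₋` (the negative powers of `Δ`). -/
def minus (A : PseudoDiffOp K) : PseudoDiffOp K :=
  ⟨fun j n => if 0 ≤ j then 0 else A.coeff j n, 0, fun _ hj _ => if_pos hj.le⟩

/-- The action `B(φ)` of a difference operator `B = B₊` on a sequence. -/
def act (B : PseudoDiffOp K) (φ : ℤ → K) (n : ℤ) : K :=
  ∑ᶠ j : ℤ, B.coeff j n * φ (n + j)

/-- The action `B*(φ)` of the formal adjoint of a difference operator `B = B₊` on a sequence, where
`(b Λ ^ j)* = Λ ^ (-j) ∘ b`; in particular `Δ* = Λ⁻¹ - 1`. -/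
def adjointAct (B : PseudoDiffOp K) (φ : ℤ → K) (n : ℤ) : K :=
  ∑ᶠ j : ℤ, B.coeff j (n - j) * φ (n - j)

theorem Delta_bound : ∀ j, (1 : ℤ) < j → ∀ n, (Delta : PseudoDiffOp K).coeff j n = 0 :=
  fun j hj _ => by
    change (if j = 1 then (1 : K) else if j = 0 then -1 else 0) = 0
    rw [if_neg (by omega), if_neg (by omega)]

theorem Delta_coeff (j n : ℤ) : (Delta : PseudoDiffOp K).coeff j n
    = if j = 1 then 1 else if j = 0 then -1 else 0 := rfl

theorem DeltaInv_coeff (j n : ℤ) : (DeltaInv : PseudoDiffOp K).coeff j n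
    = if j ≤ -1 then 1 else 0 := rfl

theorem ofSeq_coeff (φ : ℤ → K) (j n : ℤ) :
    (ofSeq φ).coeff j n = if j = 0 then φ n else 0 := rfl

theorem DeltaInv_bound : ∀ j, (-1 : ℤ) < j → ∀ n, (DeltaInv : PseudoDiffOp K).coeff j n = 0 :=
  fun j hj _ => by rw [DeltaInv_coeff, if_neg (by omega)]

theorem coeff_ofSeq_mul (φ : ℤ → K) (A : PseudoDiffOp K) (j n : ℤ) :
    (ofSeq φ * A).coeff j n = φ n * A.coeff j n := by
  rw [coeff_mul, finsum_eq_single _ 0 (fun i hi => by simp [ofSeq_coeff, hi])]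
  simp [ofSeq_coeff]

theorem coeff_Delta_mul (A : PseudoDiffOp K) (j n : ℤ) :
    (Delta * A).coeff j n = A.coeff (j - 1) (n + 1) - A.coeff j n := by
  have h : (∑ᶠ i : ℤ, (Delta : PseudoDiffOp K).coeff i n * A.coeff (j - i) (n + i))
      = ∑ i ∈ ({1, 0} : Finset ℤ), (Delta : PseudoDiffOp K).coeff i n * A.coeff (j - i) (n + i) := by
    apply finsum_eq_sum_of_support_subset
    intro i hi
    by_contra h
    simp only [Finset.coe_insert, Finset.coe_singleton, Set.mem_insert_iff,
      Set.mem_singleton_iff, not_or] at h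
    apply hi
    simp [Delta_coeff, h.1, h.2]
  rw [coeff_mul, h]
  simp [Delta_coeff, sub_eq_add_neg]

/-- The commutation rule `Δ ∘ φ = Λ(φ) ∘ Δ + Δ(φ)`. -/
theorem Delta_mul_ofSeq (φ : ℤ → K) :
    Delta * ofSeq φ = ofSeq (fun n => φ (n + 1)) * Delta + ofSeq (fwdDiff (1 : ℤ) φ) := by
  ext j n
  rw [coeff_Delta_mul, coeff_add, coeff_ofSeq_mul]
  simp only [ofSeq_coeff, Delta_coeff, fwdDiff]
  by_cases h1 : j = 1
  · subst h1; simp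
  · by_cases h0 : j = 0
    · subst h0
      norm_num
      ring
    · have : ¬ j - 1 = 0 := by omega
      simp [h1, h0, this]

theorem Delta_mul_DeltaInv : (Delta : PseudoDiffOp K) * DeltaInv = 1 := by
  ext j n
  rw [coeff_Delta_mul, coeff_one]
  simp only [DeltaInv_coeff]
  by_cases h0 : j = 0
  · subst h0; simp
  · by_cases h1 : j ≤ -1
    · rw [if_pos (by omega), if_pos h1, if_neg h0, sub_self]
    · rw [if_neg (by omega), if_neg h1, if_neg h0, sub_self]

theorem Delta_pow_bound (i : ℕ) : ∀ j, (i : ℤ) < j → ∀ n,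
    ((Delta : PseudoDiffOp K) ^ i).coeff j n = 0 := by
  induction i with
  | zero => intro j hj n; rw [pow_zero, coeff_one, if_neg (by rintro rfl; simp at hj)]
  | succ i ih =>
    intro j hj n
    push_cast at hj
    rw [pow_succ', coeff_Delta_mul, ih _ (by omega), ih _ (by omega), sub_zero]

theorem Delta_pow_lead (i : ℕ) (n : ℤ) : ((Delta : PseudoDiffOp K) ^ i).coeff i n = 1 := by
  induction i generalizing n with
  | zero => simp [coeff_one]
  | succ i ih =>
    rw [pow_succ', coeff_Delta_mul, Delta_pow_bound i ((i + 1 : ℕ) : ℤ) (by push_cast; omega),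
      sub_zero]
    have : ((i + 1 : ℕ) : ℤ) - 1 = i := by push_cast; ring
    rw [this, ih]

theorem Delta_pow_neg (i : ℕ) : ∀ j < 0, ∀ n, ((Delta : PseudoDiffOp K) ^ i).coeff j n = 0 := by
  induction i with
  | zero => intro j hj n; rw [pow_zero, coeff_one, if_neg (by omega)]
  | succ i ih =>
    intro j hj n
    rw [pow_succ', coeff_Delta_mul, ih _ (by omega), ih _ (by omega), sub_zero]

/-- `(φ Δ ^ i)₋ = 0` for `i ≥ 0`. -/
theorem minus_ofSeq_mul_Delta_pow (φ : ℤ → K) (i : ℕ) : minus (ofSeq φ * Delta ^ i) = 0 := by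
  ext j n
  change (if 0 ≤ j then 0 else (ofSeq φ * Delta ^ i).coeff j n) = 0
  split_ifs with h
  · rfl
  · rw [coeff_ofSeq_mul, Delta_pow_neg i j (by omega), mul_zero]

/-- `(φ Δ ^ (-i))₊ = 0` for `i ≥ 1`. -/
theorem plus_ofSeq_mul_DeltaInv_pow (φ : ℤ → K) (i : ℕ) :
    plus (ofSeq φ * DeltaInv ^ (i + 1)) = 0 := by
  have hb : ∀ i : ℕ, ∀ j, (-1 : ℤ) < j → ∀ n,
      ((DeltaInv : PseudoDiffOp K) ^ (i + 1)).coeff j n = 0 := by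
    intro i
    induction i with
    | zero => simpa using DeltaInv_bound
    | succ i ih =>
      intro j hj n
      rw [pow_succ]
      exact mul_bound ih DeltaInv_bound j (by omega) n
  ext j n
  change (if 0 ≤ j then (ofSeq φ * DeltaInv ^ (i + 1)).coeff j n else 0) = 0
  split_ifs with h
  · rw [coeff_ofSeq_mul, hb i j (by omega), mul_zero]
  · rfl

/-- Coefficients of the right inverse of an operator of order `N`, from the top down. -/
def invAux (A : PseudoDiffOp K) (N : ℤ) : ℕ → ℤ → K
  | s => fun n => ((if s = 0 then 1 else 0) -
      ∑ p : Fin s, A.coeff (N - s + p) (n - N) * invAux A N p (n - s + p)) / A.coeff N (n - N)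
termination_by s => s
decreasing_by exact p.2

theorem exists_right_inv (A : PseudoDiffOp K) (N : ℤ) (hN : ∀ j, N < j → ∀ n, A.coeff j n = 0)
    (h0 : ∀ n, A.coeff N n ≠ 0) : ∃ V : PseudoDiffOp K, A * V = 1 ∧
      (∀ j, -N < j → ∀ n, V.coeff j n = 0) ∧ ∀ n, V.coeff (-N) n ≠ 0 := by
  have hV : ∀ j, -N < j → ∀ n : ℤ,
      (if j ≤ -N then invAux A N (-N - j).toNat n else (0 : K)) = 0 :=
    fun j hj n => if_neg (by omega)
  refine ⟨⟨fun j n => if j ≤ -N then invAux A N (-N - j).toNat n else 0, -N, hV⟩, ?_, hV, ?_⟩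
  · ext j n
    rw [coeff_mul_eq hN hV, coeff_one]
    rcases lt_or_ge 0 j with hj | hj
    · rw [Finset.Icc_eq_empty (by omega), Finset.sum_empty, if_neg (by omega)]
    · obtain ⟨s, rfl⟩ : ∃ s : ℕ, j = -(s : ℤ) := ⟨(-j).toNat, by omega⟩
      have h1 : ∑ i ∈ Finset.Icc (-(s : ℤ) - -N) N, A.coeff i n *
            (if -(s : ℤ) - i ≤ -N then invAux A N (-N - (-(s : ℤ) - i)).toNat (n + i) else 0)
          = ∑ p ∈ Finset.range (s + 1), A.coeff (N - s + p) n * invAux A N p (n + N - s + p) := by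
        refine Finset.sum_bij' (fun i _ => (i - N + s).toNat) (fun p _ => N - s + p) ?_ ?_ ?_ ?_ ?_
        · intro i hi
          simp only [Finset.mem_Icc, Finset.mem_range] at hi ⊢
          omega
        · intro p hp
          simp only [Finset.mem_Icc, Finset.mem_range] at hp ⊢
          omega
        · intro i hi
          simp only [Finset.mem_Icc] at hi
          omega
        · intro p hp
          omega
        · intro i hi
          simp only [Finset.mem_Icc] at hi
          have e1 : N - s + ((i - N + s).toNat : ℤ) = i := by omega
          have e2 : n + N - s + ((i - N + s).toNat : ℤ) = n + i := by omega
          have e3 : (-N - (-(s : ℤ) - i)).toNat = (i - N + s).toNat := by omega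
          rw [if_pos (by omega), e1, e2, e3]
      refine h1.trans ?_
      rw [Finset.sum_range_succ]
      have e1 : N - (s : ℤ) + s = N := by ring
      have e2 : n + N - (s : ℤ) + s = n + N := by ring
      rw [e1, e2]
      have h2 : A.coeff N n * invAux A N s (n + N) = (if s = 0 then 1 else 0) -
          ∑ p ∈ Finset.range s, A.coeff (N - s + p) n * invAux A N p (n + N - s + p) := by
        rw [invAux, Finset.sum_range]
        have e3 : n + N - N = n := by ring
        dsimp only
        rw [e3, mul_div_cancel₀ _ (h0 n)]
      rw [h2, add_sub_cancel]
      simp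
  · intro n
    change (if -N ≤ -N then invAux A N (-N - -N).toNat n else (0 : K)) ≠ 0
    rw [if_pos le_rfl, sub_self, Int.toNat_zero, invAux]
    simpa using h0 (n - N)

/-- An operator whose leading coefficient vanishes nowhere is invertible. -/
theorem isUnit_of_lead (A : PseudoDiffOp K) (N : ℤ) (hN : ∀ j, N < j → ∀ n, A.coeff j n = 0)
    (h0 : ∀ n, A.coeff N n ≠ 0) : IsUnit A := by
  obtain ⟨V, hV, hb, hl⟩ := exists_right_inv A N hN h0
  obtain ⟨U, hU, -, -⟩ := exists_right_inv V (-N) hb hl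
  have : A = U := by
    calc A = A * (V * U) := by rw [hU, mul_one]
      _ = U := by rw [← mul_assoc, hV, one_mul]
  exact ⟨⟨A, V, hV, by rw [this]; exact hU⟩, rfl⟩

end PseudoDiffOp

/-- The `Δ`-Wronskian `W_p^Δ(f₁, …, f_p) = det (Δ ^ r f_c)`, `r = 0, …, p - 1`. -/
def deltaWronskian {K : Type*} [Field K] {p : ℕ} (f : Fin p → ℤ → K) (n : ℤ) : K :=
  Matrix.det (Matrix.of fun r c : Fin p => (fwdDiff (1 : ℤ))^[(r : ℕ)] (f c) n)

/-- Coefficient of `Δ ^ i` in the gauge operator `gaugeOp` below: the cofactor of the entry `Δ ^ i`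
of the last column, divided by the Wronskian. -/
def gaugeCoeff {K : Type*} [Field K] {m : ℕ} (f : Fin m → ℤ → K) (i : Fin (m + 1)) (n : ℤ) : K :=
  Matrix.det (Matrix.of fun r : Fin (m + 1) =>
    (Fin.snoc (fun c : Fin m => (fwdDiff (1 : ℤ))^[(r : ℕ)] (f c) n)
      (if r = i then 1 else 0) : Fin (m + 1) → K)) / deltaWronskian f n

/-- The gauge (dressing) operator
`T_m = W_m^Δ(f)⁻¹ * det [[f₁, …, f_m, 1], [Δ f₁, …, Δ f_m, Δ], …, [Δ^m f₁, …, Δ^m f_m, Δ^m]]`,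
where the determinant is expanded along its last column with the cofactors on the left. -/
def gaugeOp {K : Type*} [Field K] {m : ℕ} (f : Fin m → ℤ → K) : PseudoDiffOp K :=
  ∑ i : Fin (m + 1), PseudoDiffOp.ofSeq (gaugeCoeff f i) * PseudoDiffOp.Delta ^ (i : ℕ)

theorem gaugeCoeff_last {K : Type*} [Field K] {m : ℕ} (f : Fin m → ℤ → K) (n : ℤ)
    (h : deltaWronskian f n ≠ 0) : gaugeCoeff f (Fin.last m) n = 1 := by
  rw [gaugeCoeff, div_eq_one_iff_eq h, Matrix.det_succ_column _ (Fin.last m),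
    Finset.sum_eq_single (Fin.last m)]
  · simp only [Matrix.of_apply, Fin.snoc_last, if_true, mul_one, Fin.val_last]
    rw [← two_mul, pow_mul]
    simp only [neg_one_sq, one_pow, one_mul]
    rw [deltaWronskian]
    congr 1
    ext r c
    simp
  · intro b _ hb
    simp [hb]
  · simp

/-- The gauge operator is invertible where the Wronskian does not vanish, so that the inverse in
the definition of `laxOp` is a genuine one. -/
theorem isUnit_gaugeOp {K : Type*} [Field K] {m : ℕ} (f : Fin m → ℤ → K)
    (h : ∀ n, deltaWronskian f n ≠ 0) : IsUnit (gaugeOp f) := by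
  have hsum : ∀ j n, (gaugeOp f).coeff j n = ∑ i : Fin (m + 1),
      gaugeCoeff f i n * ((PseudoDiffOp.Delta : PseudoDiffOp K) ^ (i : ℕ)).coeff j n := by
    intro j n
    have hadd : ∀ s : Finset (Fin (m + 1)), (∑ i ∈ s, PseudoDiffOp.ofSeq (gaugeCoeff f i) *
        PseudoDiffOp.Delta ^ (i : ℕ)).coeff j n = ∑ i ∈ s,
      gaugeCoeff f i n * ((PseudoDiffOp.Delta : PseudoDiffOp K) ^ (i : ℕ)).coeff j n := by
      intro s
      induction s using Finset.cons_induction with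
      | empty => simp
      | cons a s ha ih =>
        rw [Finset.sum_cons, Finset.sum_cons, PseudoDiffOp.coeff_add, ih,
          PseudoDiffOp.coeff_ofSeq_mul]
    exact hadd _
  refine PseudoDiffOp.isUnit_of_lead _ (m : ℤ) (fun j hj n => ?_) (fun n => ?_)
  · rw [hsum]
    refine Finset.sum_eq_zero fun i _ => ?_
    rw [PseudoDiffOp.Delta_pow_bound _ _ (by have := i.2; omega), mul_zero]
  · rw [hsum, Finset.sum_eq_single (Fin.last m)]
    · have := PseudoDiffOp.Delta_pow_lead (K := K) m n
      simp [gaugeCoeff_last f n (h n), this]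
    · intro i _ hi
      have : (i : ℕ) < m := by
        have := i.2
        have h2 : (i : ℕ) ≠ m := fun h => hi (Fin.ext h)
        omega
      rw [PseudoDiffOp.Delta_pow_bound _ _ (by omega), mul_zero]
    · simp

/-- The Lax operator `L = W ∘ Δ ∘ W⁻¹ = T_m ∘ Δ ∘ T_m⁻¹` generated by the `τ`-function
`W_m^Δ(f₁, …, f_m)`, with `W = T_m ∘ Δ ^ (-m) = 1 + w₁ Δ⁻¹ + ⋯` (and `Δ ^ (-m)` commutes with
`Δ`). -/
def laxOp {K : Type*} [Field K] {m : ℕ} (f : Fin m → ℤ → K) : PseudoDiffOp K :=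
  gaugeOp f * PseudoDiffOp.Delta * Ring.inverse (gaugeOp f)

/-- The right-hand side `∑ q_i Δ⁻¹ r_i` of the `M`-component constraint. -/
def sumDeltaInv {K : Type*} [Field K] {M : ℕ} (q r : Fin M → ℤ → K) : PseudoDiffOp K :=
  ∑ i, PseudoDiffOp.ofSeq (q i) * PseudoDiffOp.DeltaInv * PseudoDiffOp.ofSeq (r i)

section Times

variable {𝕜 K : Type*} [RCLike 𝕜] [RCLike K] [NormedAlgebra 𝕜 K]

/-- A set `D` of times `t = (t₁, t₂, …)` in which every single time can be varied a little; for
instance any open subset of `ℕ+ → 𝕜`, or the set of all sequences with finitely many nonzero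
terms. -/
def IsTimeDomain (D : Set (ℕ+ → 𝕜)) : Prop :=
  ∀ t ∈ D, ∀ l : ℕ+, ∀ᶠ s in 𝓝 (t l), Function.update t l s ∈ D

/-- `∂ u / ∂ t_l = v` at the time `t`. -/
def HasTimeDerivAt (u : (ℕ+ → 𝕜) → K) (v : K) (l : ℕ+) (t : ℕ+ → 𝕜) : Prop :=
  HasDerivAt (fun s => u (Function.update t l s)) v (t l)

/-- `u(t, n)` is an analytic function of each time `t_l` on `D`. -/
def IsTimeAnalyticOn (D : Set (ℕ+ → 𝕜)) (u : (ℕ+ → 𝕜) → ℤ → K) : Prop :=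
  ∀ t ∈ D, ∀ n : ℤ, ∀ l : ℕ+, AnalyticAt 𝕜 (fun s => u (Function.update t l s) n) (t l)

/-- The linear flows `∂ u / ∂ t_l = Δ ^ l u`, `l = 1, 2, …`. -/
def IsLinearFlowOn (D : Set (ℕ+ → 𝕜)) (u : (ℕ+ → 𝕜) → ℤ → K) : Prop :=
  ∀ t ∈ D, ∀ n : ℤ, ∀ l : ℕ+,
    HasTimeDerivAt (fun t' => u t' n) ((fwdDiff (1 : ℤ))^[(l : ℕ)] (u t) n) l t

/-- The Lax equations `∂ L / ∂ t_l = [B_l, L]`, `B_l = (L ^ l)₊`, `l = 1, 2, …`, of the discrete KP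
hierarchy (`∂ / ∂ t_l` acts on the coefficients). -/
def IsLaxSolutionOn (D : Set (ℕ+ → 𝕜)) (L : (ℕ+ → 𝕜) → PseudoDiffOp K) : Prop :=
  ∀ t ∈ D, ∀ l : ℕ+, ∀ j n : ℤ, HasTimeDerivAt (fun t' => (L t').coeff j n)
    (((L t ^ (l : ℕ)).plus * L t - L t * (L t ^ (l : ℕ)).plus).coeff j n) l t

/-- `q` is an eigenfunction of `L`: `∂ q / ∂ t_l = B_l(q)` for all `l`. -/
def IsEigenfunctionOn (D : Set (ℕ+ → 𝕜)) (L : (ℕ+ → 𝕜) → PseudoDiffOp K)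
    (q : (ℕ+ → 𝕜) → ℤ → K) : Prop :=
  ∀ t ∈ D, ∀ l : ℕ+, ∀ n : ℤ,
    HasTimeDerivAt (fun t' => q t' n) ((L t ^ (l : ℕ)).plus.act (q t) n) l t

/-- `r` is an adjoint eigenfunction of `L`: `∂ r / ∂ t_l = -B_l*(r)` for all `l`. -/
def IsAdjointEigenfunctionOn (D : Set (ℕ+ → 𝕜)) (L : (ℕ+ → 𝕜) → PseudoDiffOp K)
    (r : (ℕ+ → 𝕜) → ℤ → K) : Prop :=
  ∀ t ∈ D, ∀ l : ℕ+, ∀ n : ℤ,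
    HasTimeDerivAt (fun t' => r t' n) (-(L t ^ (l : ℕ)).plus.adjointAct (r t) n) l t

end Times

end

/-! The gauge operator `T = gaugeOp f` is monic of order `m` and annihilates every `f_i`. Its
inverse is `∑ f_i Δ⁻¹ g_i`, where `g_i` is `adjointBasis f i` (`inverse_gaugeOp`). Since `(A ∘ φ Δ⁻¹
ψ)₋ = A(φ) Δ⁻¹ ψ`, this gives `(L ^ k)₋ = ∑ h_i Δ⁻¹ g_i` with `h_i = T(Δ ^ k f_i)`
(`minus_laxOp_pow`). By linearity of the determinant `h_i` is the Wronskian ratio of statement 4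
(`gaugeOp_act`), and the Wronskian identity is a unitriangular row operation built from `T`
(`deltaWronskian_append`).

Differentiating `T(f_i) = 0` yields Sato's equation, because an operator of order below `m` that
kills all `f_i` is zero. The Lax equations follow from it; so do the facts that the `h_i` are
eigenfunctions and the `g_i` adjoint eigenfunctions.

1 → 4: the coefficients of `∑ h_i Δ⁻¹ g_i` form matrix products `H G` with `G` invertible. If they
equal products `Q R` through `K ^ M`, then all minors of `H` of size `M + 1` vanish.

3 → 2 is the main point. Vanishing of a Casorati determinant for all `n` does not by itself imply
linear dependence, so the first time is used. On solutions of `∂y/∂t₁ = Δ y` the `Δ`-Wronskian at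
fixed `n` is the ordinary Wronskian in `t₁`; analyticity then gives a linear relation at `n`, which
propagates to all larger `n`. The relation spaces shrink as `n → -∞` but stay nonzero, so by finite
dimension they stabilise to a relation valid for all `n`
(`not_linearIndependent_of_deltaWronskian_append`). This works with the `f_i` and `Δ ^ k f_i`, which
obey the linear flow, rather than with the `h_i`. Hence the relations among the `h_i` have
codimension at most `M`. They are locally constant in each time (`linearRelations_gaugeOp_act_le`),
so `∑ h_i Δ⁻¹ g_i` can be regrouped into `M` terms with locally constant coefficients, which keeps
the (adjoint) eigenfunction property. -/

namespace PseudoDiffOp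

/-! ### Algebra of pseudo-difference operators and their action on sequences. -/

variable {K : Type*} [Field K]

@[simp] theorem coeff_sub (A B : PseudoDiffOp K) (j n : ℤ) :
    (A - B).coeff j n = A.coeff j n - B.coeff j n := by
  rw [sub_eq_add_neg, coeff_add, coeff_neg, sub_eq_add_neg]

theorem coeff_sum {ι : Type*} (s : Finset ι) (A : ι → PseudoDiffOp K) (j n : ℤ) :
    (∑ i ∈ s, A i).coeff j n = ∑ i ∈ s, (A i).coeff j n := by
  induction s using Finset.cons_induction with
  | empty => simp
  | cons a s ha ih => rw [Finset.sum_cons, Finset.sum_cons, coeff_add, ih]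

theorem plus_coeff (A : PseudoDiffOp K) (j n : ℤ) :
    A.plus.coeff j n = if 0 ≤ j then A.coeff j n else 0 := rfl

theorem minus_coeff (A : PseudoDiffOp K) (j n : ℤ) :
    A.minus.coeff j n = if 0 ≤ j then 0 else A.coeff j n := rfl

theorem plus_add_minus (A : PseudoDiffOp K) : A.plus + A.minus = A := by
  ext j n
  rw [coeff_add, plus_coeff, minus_coeff]
  split_ifs <;> simp

theorem minus_add (A B : PseudoDiffOp K) : (A + B).minus = A.minus + B.minus := by
  ext j n
  simp only [coeff_add, minus_coeff]
  split_ifs <;> simp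

theorem minus_sub (A B : PseudoDiffOp K) : (A - B).minus = A.minus - B.minus := by
  ext j n
  simp only [coeff_sub, minus_coeff]
  split_ifs <;> simp

theorem minus_sum {ι : Type*} (s : Finset ι) (A : ι → PseudoDiffOp K) :
    (∑ i ∈ s, A i).minus = ∑ i ∈ s, (A i).minus := by
  ext j n
  simp only [coeff_sum, minus_coeff]
  split_ifs <;> simp

/-- The operator has order at most `N`. -/
def OrderLE (A : PseudoDiffOp K) (N : ℤ) : Prop := ∀ j, N < j → ∀ n, A.coeff j n = 0

/-- The operator is a difference operator: `A = A₊`. -/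
def IsDifference (A : PseudoDiffOp K) : Prop := ∀ j < 0, ∀ n, A.coeff j n = 0

theorem OrderLE.mul {A B : PseudoDiffOp K} {a b : ℤ} (ha : A.OrderLE a) (hb : B.OrderLE b) :
    (A * B).OrderLE (a + b) := mul_bound ha hb

theorem orderLE_minus (A : PseudoDiffOp K) : A.minus.OrderLE (-1) :=
  fun j hj n => if_pos (by omega)

theorem OrderLE.mono {A : PseudoDiffOp K} {a b : ℤ} (ha : A.OrderLE a) (h : a ≤ b) :
    A.OrderLE b := fun j hj n => ha j (by omega) n

theorem isDifference_plus (A : PseudoDiffOp K) : A.plus.IsDifference :=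
  fun j hj n => if_neg (by omega)

theorem isDifference_ofSeq (φ : ℤ → K) : (ofSeq φ).IsDifference :=
  fun j hj n => if_neg (by omega)

theorem isDifference_Delta_pow (i : ℕ) : ((Delta : PseudoDiffOp K) ^ i).IsDifference :=
  Delta_pow_neg i

theorem isDifference_Delta : (Delta : PseudoDiffOp K).IsDifference := by
  simpa using isDifference_Delta_pow (K := K) 1

theorem IsDifference.mul {A B : PseudoDiffOp K} (hA : A.IsDifference) (hB : B.IsDifference) :
    (A * B).IsDifference := by
  intro j hj n
  rw [coeff_mul]
  refine finsum_eq_zero_of_forall_eq_zero fun i => ?_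
  rcases lt_or_ge i 0 with hi | hi
  · rw [hA i hi, zero_mul]
  · rw [hB (j - i) (by omega), mul_zero]

theorem IsDifference.sub {A B : PseudoDiffOp K} (hA : A.IsDifference) (hB : B.IsDifference) :
    (A - B).IsDifference := fun j hj n => by rw [coeff_sub, hA j hj, hB j hj, sub_zero]

theorem IsDifference.sum {ι : Type*} {s : Finset ι} {A : ι → PseudoDiffOp K}
    (hA : ∀ i ∈ s, (A i).IsDifference) : (∑ i ∈ s, A i).IsDifference := fun j hj n => by
  rw [coeff_sum]
  exact Finset.sum_eq_zero fun i hi => hA i hi j hj n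

theorem IsDifference.minus_eq_zero {A : PseudoDiffOp K} (hA : A.IsDifference) : A.minus = 0 := by
  ext j n
  rw [minus_coeff, coeff_zero]
  split_ifs with h
  · rfl
  · exact hA j (by omega) n

theorem IsDifference.finite_support {A : PseudoDiffOp K} (hA : A.IsDifference) (n : ℤ)
    (c : ℤ → K) : (Function.support fun j => A.coeff j n * c j).Finite := by
  obtain ⟨a, ha⟩ := A.bdd
  refine (Set.finite_Icc 0 a).subset fun j hj => ?_
  rw [Function.mem_support] at hj
  constructor
  · by_contra h
    exact hj (by rw [hA j (by omega), zero_mul])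
  · by_contra h
    exact hj (by rw [ha j (by omega), zero_mul])

theorem finsum_int_eq_sum_range (g : ℤ → K) (N : ℕ) (h : ∀ j, g j ≠ 0 → 0 ≤ j ∧ j < N) :
    ∑ᶠ j, g j = ∑ j ∈ Finset.range N, g j := by
  rw [finsum_eq_sum_of_support_subset (s := (Finset.range N).map Nat.castEmbedding)]
  · rw [Finset.sum_map]
    rfl
  · intro j hj
    obtain ⟨h0, h1⟩ := h j hj
    simp only [Finset.coe_map, Set.mem_image, Finset.mem_coe, Finset.mem_range]
    exact ⟨j.toNat, by omega, by simpa using h0⟩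

theorem act_eq_sum {B : PseudoDiffOp K} (hB : B.IsDifference) {N : ℕ} (hN : B.OrderLE (N - 1))
    (φ : ℤ → K) (n : ℤ) : B.act φ n = ∑ j ∈ Finset.range N, B.coeff j n * φ (n + j) := by
  refine finsum_int_eq_sum_range _ N fun j hj => ⟨?_, ?_⟩
  · by_contra h
    exact hj (by rw [hB j (by omega), zero_mul])
  · by_contra h
    exact hj (by rw [hN j (by omega), zero_mul])

/-- In powers of `Λ` the operator `φ Δ⁻¹ ψ` is a rank-one matrix `φ(n) ψ(n')` restricted to `n' <
n`. This turns identities between sums of such operators into matrix identities. -/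
theorem coeff_kernel (φ ψ : ℤ → K) (j n : ℤ) :
    (ofSeq φ * DeltaInv * ofSeq ψ).coeff j n = if j ≤ -1 then φ n * ψ (n + j) else 0 := by
  rw [coeff_mul, finsum_eq_single _ j (fun i hi => by
    rw [ofSeq_coeff, if_neg (by omega), mul_zero]), coeff_ofSeq_mul, DeltaInv_coeff, ofSeq_coeff,
    if_pos (sub_self j)]
  split_ifs <;> simp

/-- `(A ∘ φ Δ⁻¹ ψ)₋ = A(φ) Δ⁻¹ ψ` for a difference operator `A`. -/
theorem minus_mul_kernel {A : PseudoDiffOp K} (hA : A.IsDifference) (φ ψ : ℤ → K) :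
    (A * (ofSeq φ * DeltaInv * ofSeq ψ)).minus = ofSeq (A.act φ) * DeltaInv * ofSeq ψ := by
  ext j n
  rw [minus_coeff, coeff_kernel]
  rcases lt_or_ge j 0 with hj | hj
  · rw [if_neg (by omega), if_pos (by omega), coeff_mul, act,
      finsum_mul]
    refine finsum_congr fun i => ?_
    rw [coeff_kernel]
    rcases lt_or_ge i 0 with hi | hi
    · rw [hA i hi]; simp
    · rw [if_pos (by omega), mul_assoc]
      congr 3
      ring
  · rw [if_pos hj, if_neg (by omega)]

/-- `(φ Δ⁻¹ ψ ∘ B)₋ = φ Δ⁻¹ B*(ψ)` for a difference operator `B`. -/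
theorem minus_kernel_mul {B : PseudoDiffOp K} (hB : B.IsDifference) (φ ψ : ℤ → K) :
    (ofSeq φ * DeltaInv * ofSeq ψ * B).minus
      = ofSeq φ * DeltaInv * ofSeq (B.adjointAct ψ) := by
  ext j n
  rw [minus_coeff, coeff_kernel]
  rcases lt_or_ge j 0 with hj | hj
  · rw [if_neg (by omega), if_pos (by omega), coeff_mul, adjointAct, mul_finsum,
      ← finsum_comp_equiv (Equiv.subLeft j)]
    refine finsum_congr fun i => ?_
    rw [coeff_kernel, Equiv.subLeft_apply]
    have e1 : n + (j - i) = n + j - i := by ring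
    have e2 : j - (j - i) = i := by ring
    rw [e1, e2]
    rcases lt_or_ge i 0 with hi | hi
    · rw [hB i hi]; simp
    · rw [if_pos (by omega)]
      ring
  · rw [if_pos hj, if_neg (by omega)]

/-- Encodes the action inside the ring, so that properties of the action follow from associativity
of composition. -/
theorem act_eq_coeff {A : PseudoDiffOp K} (hA : A.IsDifference) (φ : ℤ → K) (n : ℤ) :
    A.act φ n = (A * (ofSeq φ * DeltaInv * ofSeq 1)).coeff (-1) n := by
  have h := congrArg (fun X : PseudoDiffOp K => X.coeff (-1) n) (minus_mul_kernel hA φ 1)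
  simp only [minus_coeff, coeff_kernel] at h
  simpa using h.symm

theorem act_mul {A B : PseudoDiffOp K} (hA : A.IsDifference) (hB : B.IsDifference) (φ : ℤ → K) :
    (A * B).act φ = A.act (B.act φ) := by
  ext n
  rw [act_eq_coeff (hA.mul hB), act_eq_coeff hA, ← minus_mul_kernel hB, mul_assoc]
  -- The nonnegative part of `B ∘ φ Δ⁻¹` stays a difference operator after multiplication by `A`, so
  -- it does not reach the coefficient of `Λ⁻¹`.
  conv_lhs => rw [← plus_add_minus (B * (ofSeq φ * DeltaInv * ofSeq 1)), mul_add, coeff_add,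
    (hA.mul (isDifference_plus _)) (-1) (by norm_num), zero_add]

theorem act_sub (A B : PseudoDiffOp K) (hA : A.IsDifference) (hB : B.IsDifference) (φ : ℤ → K)
    (n : ℤ) : (A - B).act φ n = A.act φ n - B.act φ n := by
  rw [act, act, act, ← finsum_sub_distrib (hA.finite_support n _) (hB.finite_support n _)]
  simp only [coeff_sub, sub_mul]

theorem act_sum {ι : Type*} (s : Finset ι) (A : ι → PseudoDiffOp K)
    (hA : ∀ i ∈ s, (A i).IsDifference) (φ : ℤ → K) (n : ℤ) :
    (∑ i ∈ s, A i).act φ n = ∑ i ∈ s, (A i).act φ n := by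
  simp only [act, coeff_sum, Finset.sum_mul]
  exact finsum_sum_comm s _ fun i hi => (hA i hi).finite_support n _

theorem act_ofSeq_mul (a : ℤ → K) (A : PseudoDiffOp K) (φ : ℤ → K) (n : ℤ) :
    (ofSeq a * A).act φ n = a n * A.act φ n := by
  rw [act, act, mul_finsum]
  simp only [coeff_ofSeq_mul, mul_assoc]

theorem act_Delta (φ : ℤ → K) : (Delta : PseudoDiffOp K).act φ = fwdDiff 1 φ := by
  ext n
  rw [act_eq_sum (N := 2) isDifference_Delta (by simpa [OrderLE] using Delta_bound)]
  simp [Finset.sum_range_succ, Delta_coeff, fwdDiff]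
  ring

theorem act_Delta_pow (i : ℕ) (φ : ℤ → K) :
    ((Delta : PseudoDiffOp K) ^ i).act φ = (fwdDiff (1 : ℤ))^[i] φ := by
  induction i with
  | zero =>
    ext n
    rw [pow_zero, act, finsum_eq_single _ 0 (fun j hj => by simp [coeff_one, hj])]
    simp [coeff_one]
  | succ i ih =>
    rw [pow_succ', act_mul isDifference_Delta (isDifference_Delta_pow i), ih, act_Delta,
      Function.iterate_succ_apply']

/-- A difference operator acts linearly. -/
theorem act_sum_mul {A : PseudoDiffOp K} (hA : A.IsDifference) {ι : Type*} (s : Finset ι)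
    (c : ι → K) (φ : ι → ℤ → K) (n : ℤ) :
    A.act (fun n => ∑ i ∈ s, c i * φ i n) n = ∑ i ∈ s, c i * A.act (φ i) n := by
  simp only [act, Finset.mul_sum]
  rw [finsum_sum_comm s _ fun i _ => hA.finite_support n _]
  refine Finset.sum_congr rfl fun i _ => ?_
  rw [mul_finsum]
  exact finsum_congr fun j => by ring

theorem act_zero (A : PseudoDiffOp K) (n : ℤ) : A.act (fun _ => 0) n = 0 := by
  simp [act]

theorem adjointAct_sum_mul {A : PseudoDiffOp K} (hA : A.IsDifference) {ι : Type*} (s : Finset ι)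
    (c : ι → K) (φ : ι → ℤ → K) (n : ℤ) :
    A.adjointAct (fun n => ∑ i ∈ s, c i * φ i n) n = ∑ i ∈ s, c i * A.adjointAct (φ i) n := by
  have hfin : ∀ ψ : ℤ → K,
      (Function.support fun j => A.coeff j (n - j) * ψ (n - j)).Finite := by
    intro ψ
    obtain ⟨a, ha⟩ := A.bdd
    refine (Set.finite_Icc 0 a).subset fun j hj => ?_
    rw [Function.mem_support] at hj
    constructor
    · by_contra h
      exact hj (by rw [hA j (by omega), zero_mul])
    · by_contra h
      exact hj (by rw [ha j (by omega), zero_mul])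
  simp only [adjointAct, Finset.mul_sum]
  rw [finsum_sum_comm s _ fun i _ => hfin fun k => c i * φ i k]
  refine Finset.sum_congr rfl fun i _ => ?_
  rw [mul_finsum]
  exact finsum_congr fun j => by ring

end PseudoDiffOp

open PseudoDiffOp in
theorem coeff_sumDeltaInv {K : Type*} [Field K] {M : ℕ} (q r : Fin M → ℤ → K) (j n : ℤ) :
    (sumDeltaInv q r).coeff j n = if j ≤ -1 then ∑ i, q i n * r i (n + j) else 0 := by
  simp only [sumDeltaInv, coeff_sum, coeff_kernel]
  split_ifs <;> simp

open PseudoDiffOp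

/-! ### Casorati determinants, the gauge operator and its inverse. -/

section Casorati

variable {K : Type*} [Field K]

/-- The Casorati matrix `f_c(n + r)`. -/
def casorati {p : ℕ} (f : Fin p → ℤ → K) (n : ℤ) : Matrix (Fin p) (Fin p) K :=
  Matrix.of fun r c => f c (n + (r : ℕ))

/-- `Δ ^ r` is `Λ ^ r` plus lower powers, so the two matrices differ by a unitriangular row
operation. -/
theorem deltaWronskian_eq_det_casorati {p : ℕ} (f : Fin p → ℤ → K) (n : ℤ) :
    deltaWronskian f n = (casorati f n).det := by
  set U : Matrix (Fin p) (Fin p) K :=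
    Matrix.of fun r j => ((Delta : PseudoDiffOp K) ^ (r : ℕ)).coeff (j : ℕ) n with hU
  have hdet : U.det = 1 := by
    rw [Matrix.det_of_isLowerTriangular]
    · exact Finset.prod_eq_one fun _ _ => Delta_pow_lead _ _
    · intro i j hij
      have : (i : ℕ) < j := hij
      exact Delta_pow_bound _ _ (by omega) _
  have hmul : (Matrix.of fun r c : Fin p => (fwdDiff (1 : ℤ))^[(r : ℕ)] (f c) n)
      = U * casorati f n := by
    ext r c
    rw [Matrix.of_apply, ← act_Delta_pow, act_eq_sum (isDifference_Delta_pow _) (N := p)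
      (fun j hj => Delta_pow_bound _ j (by have := r.2; omega)), Finset.sum_range]
    rfl
  rw [deltaWronskian, hmul, Matrix.det_mul, hdet, one_mul]

/-- A difference operator of order less than `m` that annihilates `m` sequences with nonvanishing
Wronskian is zero. -/
theorem PseudoDiffOp.eq_zero_of_act_eq_zero {m : ℕ} {f : Fin m → ℤ → K}
    (hf : ∀ n, deltaWronskian f n ≠ 0) {X : PseudoDiffOp K} (hX : X.IsDifference)
    (hm : X.OrderLE (m - 1)) (h : ∀ i n, X.act (f i) n = 0) : X = 0 := by
  ext j n
  rw [coeff_zero]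
  by_cases hj : 0 ≤ j ∧ j < m
  · have hv : (fun i : Fin m => X.coeff (i : ℕ) n) = 0 := by
      apply Matrix.eq_zero_of_vecMul_eq_zero (M := casorati f n)
      · rw [← deltaWronskian_eq_det_casorati]
        exact hf n
      · ext i
        have := h i n
        rw [act_eq_sum hX hm, Finset.sum_range] at this
        exact this
    have := congrFun hv ⟨j.toNat, by omega⟩
    simpa [hj.1] using this
  · by_cases h0 : 0 ≤ j
    · exact hm j (by omega) n
    · exact hX j (by omega) n

theorem isDifference_gaugeOp {m : ℕ} (f : Fin m → ℤ → K) : (gaugeOp f).IsDifference :=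
  IsDifference.sum fun _ _ => (isDifference_ofSeq _).mul (isDifference_Delta_pow _)

theorem coeff_gaugeOp {m : ℕ} (f : Fin m → ℤ → K) (j n : ℤ) :
    (gaugeOp f).coeff j n = ∑ i : Fin (m + 1),
      gaugeCoeff f i n * ((Delta : PseudoDiffOp K) ^ (i : ℕ)).coeff j n := by
  rw [gaugeOp, coeff_sum]
  exact Finset.sum_congr rfl fun i _ => coeff_ofSeq_mul _ _ _ _

theorem orderLE_gaugeOp {m : ℕ} (f : Fin m → ℤ → K) : (gaugeOp f).OrderLE m := by
  intro j hj n
  rw [coeff_gaugeOp]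
  refine Finset.sum_eq_zero fun i _ => ?_
  rw [Delta_pow_bound _ _ (by have := i.2; omega), mul_zero]

theorem gaugeOp_act_eq_sum {m : ℕ} (f : Fin m → ℤ → K) (φ : ℤ → K) (n : ℤ) :
    (gaugeOp f).act φ n = ∑ j ∈ Finset.range (m + 1), (gaugeOp f).coeff j n * φ (n + j) :=
  act_eq_sum (isDifference_gaugeOp f) ((orderLE_gaugeOp f).mono (by simp)) φ n

theorem coeff_gaugeOp_top {m : ℕ} (f : Fin m → ℤ → K) (n : ℤ) (h : deltaWronskian f n ≠ 0) :
    (gaugeOp f).coeff m n = 1 := by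
  rw [coeff_gaugeOp, Fin.sum_univ_castSucc, Finset.sum_eq_zero, gaugeCoeff_last f n h, zero_add,
    Fin.val_last, Delta_pow_lead, one_mul]
  intro _ _
  rw [Delta_pow_bound _ _ (by simp), mul_zero]

/-- The determinant is linear in its last column; applying `T` to `φ` replaces each formal `Δ ^ i`
there by `Δ ^ i φ`. -/
theorem gaugeOp_act {m : ℕ} (f : Fin m → ℤ → K) (φ : ℤ → K) (n : ℤ) :
    (gaugeOp f).act φ n
      = deltaWronskian (Fin.snoc f φ : Fin (m + 1) → ℤ → K) n / deltaWronskian f n := by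
  -- Linearity in the last column is taken from Cramer's map, which overwrites that column; the zero
  -- placed there is a dummy.
  have key : ∀ v : Fin (m + 1) → K,
      (Matrix.of fun r : Fin (m + 1) =>
        (Fin.snoc (fun c : Fin m => (fwdDiff (1 : ℤ))^[(r : ℕ)] (f c) n) (v r) :
          Fin (m + 1) → K)).det
      = Matrix.cramer (Matrix.of fun r : Fin (m + 1) =>
        (Fin.snoc (fun c : Fin m => (fwdDiff (1 : ℤ))^[(r : ℕ)] (f c) n) 0 :
          Fin (m + 1) → K)) v (Fin.last m) := by
    intro v
    rw [Matrix.cramer_apply]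
    congr 1
    ext r c
    refine Fin.lastCases ?_ (fun c => ?_) c
    · simp
    · rw [Matrix.updateCol_ne (Fin.castSucc_lt_last c).ne]
      simp
  rw [gaugeOp, act_sum _ _
    fun i _ => (isDifference_ofSeq _).mul (isDifference_Delta_pow _)]
  have hW : deltaWronskian (Fin.snoc f φ : Fin (m + 1) → ℤ → K) n
      = (Matrix.of fun r : Fin (m + 1) =>
        (Fin.snoc (fun c : Fin m => (fwdDiff (1 : ℤ))^[(r : ℕ)] (f c) n)
          ((fwdDiff (1 : ℤ))^[(r : ℕ)] φ n) : Fin (m + 1) → K)).det := by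
    rw [deltaWronskian]
    congr 1
    ext r c
    refine Fin.lastCases ?_ (fun c => ?_) c <;> simp
  rw [hW, key, LinearMap.pi_apply_eq_sum_univ, Finset.sum_apply, Finset.sum_div]
  refine Finset.sum_congr rfl fun i _ => ?_
  rw [act_ofSeq_mul, act_Delta_pow, gaugeCoeff, key, Pi.smul_apply, smul_eq_mul, div_mul_eq_mul_div,
    mul_comm]
  simp only [eq_comm]

theorem gaugeOp_act_self {m : ℕ} (f : Fin m → ℤ → K) (i : Fin m) (n : ℤ) :
    (gaugeOp f).act (f i) n = 0 := by
  rw [gaugeOp_act, deltaWronskian, Matrix.det_zero_of_column_eq (Fin.castSucc_lt_last i).ne,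
    zero_div]
  intro r
  simp

/-- `W_{m+p}(f, φ) = W_m(f) W_p(T_m φ)`. -/
theorem deltaWronskian_append {m p : ℕ} (f : Fin m → ℤ → K) (hf : ∀ n, deltaWronskian f n ≠ 0)
    (φ : Fin p → ℤ → K) (n : ℤ) :
    deltaWronskian (Fin.append f φ) n
      = deltaWronskian f n * deltaWronskian (fun j => (gaugeOp f).act (φ j)) n := by
  simp only [deltaWronskian_eq_det_casorati]
  set T := gaugeOp f with hT
  -- The first `m` rows are those of the identity; row `m + s` lists the coefficients of `Λ ^ s ∘
  -- T`. Since `T` is monic of order `m`, `U` is unitriangular, and `T(f_i) = 0` makes the product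
  -- block triangular.
  set U : Matrix (Fin (m + p)) (Fin (m + p)) K := Matrix.of fun r j =>
    if (r : ℕ) < m then (if r = j then 1 else 0)
    else T.coeff (j - (r - m) : ℤ) (n + (r - m)) with hU
  have hdet : U.det = 1 := by
    rw [Matrix.det_of_isLowerTriangular]
    · refine Finset.prod_eq_one fun i _ => ?_
      rw [hU, Matrix.of_apply, if_pos rfl]
      split_ifs
      · rfl
      · rw [sub_sub_cancel]
        exact coeff_gaugeOp_top f _ (hf _)
    · intro i j hij
      have : (i : ℕ) < j := hij
      rw [hU, Matrix.of_apply]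
      split_ifs with h1 h2
      · rw [h2] at this
        exact absurd this (lt_irrefl _)
      · rfl
      · exact orderLE_gaugeOp f _ (by omega) _
  have hrow : ∀ (s : Fin p) (ψ : ℤ → K),
      ∑ j : Fin (m + p), T.coeff ((j : ℕ) - (s : ℕ)) (n + (s : ℕ)) * ψ (n + (j : ℕ))
        = T.act ψ (n + (s : ℕ)) := by
    intro s ψ
    rw [act, ← finsum_comp_equiv (Equiv.subRight ((s : ℕ) : ℤ)), finsum_int_eq_sum_range _ (m + p),
      Finset.sum_range]
    · refine Finset.sum_congr rfl fun j _ => ?_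
      rw [Equiv.subRight_apply]
      congr 2
      ring
    · intro j hj
      rw [Equiv.subRight_apply] at hj
      constructor
      · by_contra h
        exact hj (by rw [isDifference_gaugeOp f _ (by omega), zero_mul])
      · by_contra h
        have := s.2
        exact hj (by rw [orderLE_gaugeOp f _ (by push_cast at h; omega), zero_mul])
  have hmul : (U * casorati (Fin.append f φ) n).submatrix finSumFinEquiv finSumFinEquiv
      = Matrix.fromBlocks (casorati f n) (Matrix.of fun (r : Fin m) c => φ c (n + (r : ℕ))) 0
        (casorati (fun j => T.act (φ j)) n) := by
    ext r c
    rw [Matrix.submatrix_apply, Matrix.mul_apply]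
    rcases r with r | r
    · have : ∀ j, U (finSumFinEquiv (Sum.inl r)) j
          = if finSumFinEquiv (Sum.inl r) = j then 1 else 0 := fun j => by
        rw [hU, Matrix.of_apply, if_pos (by simp)]
      simp only [this, ite_mul, one_mul, zero_mul, Finset.sum_ite_eq, Finset.mem_univ, if_true]
      rcases c with c | c <;> simp [casorati]
    · have : ∀ j, U (finSumFinEquiv (Sum.inr r)) j
          = T.coeff ((j : ℕ) - (r : ℕ)) (n + (r : ℕ)) := fun j => by
        rw [hU, Matrix.of_apply, if_neg (by simp)]
        simp
      simp only [this]
      refine (hrow r (Fin.append f φ (finSumFinEquiv c))).trans ?_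
      rcases c with c | c
      · simpa using gaugeOp_act_self f c _
      · simp [casorati]
  rw [← one_mul (Matrix.det _), ← hdet, ← Matrix.det_mul,
    ← Matrix.det_submatrix_equiv_self finSumFinEquiv, hmul, Matrix.det_fromBlocks_zero₂₁]

/-- The solution `g` of `∑ f_i(n + r) g_i(n - 1) = δ_{r, m - 1}`, `0 ≤ r < m`; the adjoint
functions with `T_m⁻¹ = ∑ f_i Δ⁻¹ g_i`. -/
def adjointBasis {m : ℕ} (f : Fin m → ℤ → K) (i : Fin m) (n : ℤ) : K :=
  Matrix.cramer (casorati f (n + 1)) (fun r => if (r : ℕ) + 1 = m then 1 else 0) i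
    / (casorati f (n + 1)).det

theorem sum_mul_adjointBasis {m : ℕ} (f : Fin m → ℤ → K) (hf : ∀ n, deltaWronskian f n ≠ 0)
    (n : ℤ) (r : ℕ) (hr : r < m) :
    ∑ i, f i (n + 1 + r) * adjointBasis f i n = if r + 1 = m then 1 else 0 := by
  have h := congrFun (Matrix.mulVec_cramer (casorati f (n + 1))
    (fun r => if (r : ℕ) + 1 = m then 1 else 0)) ⟨r, hr⟩
  have h0 : (casorati f (n + 1)).det ≠ 0 := by
    rw [← deltaWronskian_eq_det_casorati]
    exact hf _
  simp only [adjointBasis, ← mul_div_assoc]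
  rw [← Finset.sum_div, div_eq_iff h0, mul_comm]
  exact h

theorem minus_mul_sumDeltaInv {A : PseudoDiffOp K} (hA : A.IsDifference) {M : ℕ}
    (q r : Fin M → ℤ → K) :
    (A * sumDeltaInv q r).minus = sumDeltaInv (fun i => A.act (q i)) r := by
  rw [sumDeltaInv, Finset.mul_sum, minus_sum]
  exact Finset.sum_congr rfl fun i _ => minus_mul_kernel hA _ _

theorem minus_sumDeltaInv_mul {A : PseudoDiffOp K} (hA : A.IsDifference) {M : ℕ}
    (q r : Fin M → ℤ → K) :
    (sumDeltaInv q r * A).minus = sumDeltaInv q (fun i => A.adjointAct (r i)) := by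
  rw [sumDeltaInv, Finset.sum_mul, minus_sum]
  exact Finset.sum_congr rfl fun i _ => minus_kernel_mul hA _ _

/-- Negative powers vanish because `T(f_i) = 0`. At `Λ ^ j` with `j ≥ 0`, the equations defining the
`g_i` leave only the coefficient of `Λ ^ (j + m)` in `T`, which is `1` for `j = 0` and `0` for `j >
0`. -/
theorem gaugeOp_mul_sumDeltaInv {m : ℕ} (hm : 0 < m) (f : Fin m → ℤ → K)
    (hf : ∀ n, deltaWronskian f n ≠ 0) :
    gaugeOp f * sumDeltaInv f (adjointBasis f) = 1 := by
  ext j n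
  rcases lt_or_ge j 0 with hj | hj
  · have h := congrArg (fun X : PseudoDiffOp K => X.coeff j n)
      (minus_mul_sumDeltaInv (isDifference_gaugeOp f) f (adjointBasis f))
    simp only [minus_coeff, coeff_sumDeltaInv, gaugeOp_act_self, zero_mul, Finset.sum_const_zero,
      ite_self] at h
    rw [if_neg (by omega)] at h
    rw [h, coeff_one, if_neg (by omega)]
  · have hcoeff : ∀ i, j < i → i ≤ j + m →
        (sumDeltaInv f (adjointBasis f)).coeff (j - i) (n + i) = if i = j + m then 1 else 0 := by
      intro i h1 h2
      rw [coeff_sumDeltaInv, if_pos (by omega)]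
      have h := sum_mul_adjointBasis f hf (n + j) (i - j - 1).toNat (by omega)
      have e1 : n + j + 1 + ((i - j - 1).toNat : ℤ) = n + i := by omega
      have e2 : n + i + (j - i) = n + j := by ring
      rw [e1] at h
      rw [e2, h]
      exact if_congr (by omega) rfl rfl
    rw [coeff_mul, finsum_eq_single _ (j + m), hcoeff _ (by omega) le_rfl, if_pos rfl, mul_one,
      coeff_one]
    · split_ifs with h0
      · rw [h0, zero_add]
        exact coeff_gaugeOp_top f n (hf n)
      · exact orderLE_gaugeOp f _ (by omega) n
    · intro i hi
      by_cases h1 : m < i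
      · rw [orderLE_gaugeOp f _ h1, zero_mul]
      · by_cases h2 : j < i
        · rw [hcoeff i h2 (by omega), if_neg hi, mul_zero]
        · rw [coeff_sumDeltaInv, if_neg (by omega), mul_zero]

theorem inverse_gaugeOp {m : ℕ} (hm : 0 < m) (f : Fin m → ℤ → K)
    (hf : ∀ n, deltaWronskian f n ≠ 0) :
    Ring.inverse (gaugeOp f) = sumDeltaInv f (adjointBasis f) := by
  have hu := isUnit_gaugeOp f hf
  calc Ring.inverse (gaugeOp f)
      = Ring.inverse (gaugeOp f) * (gaugeOp f * sumDeltaInv f (adjointBasis f)) := by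
        rw [gaugeOp_mul_sumDeltaInv hm f hf, mul_one]
    _ = sumDeltaInv f (adjointBasis f) := Ring.inverse_mul_cancel_left _ _ hu

/-- For `m = 0` the sum `∑ f_i Δ⁻¹ g_i` is empty and is not the inverse of `T`, so this case is
treated separately throughout. -/
theorem gaugeOp_fin_zero (f : Fin 0 → ℤ → K) : gaugeOp f = 1 := by
  ext j n
  rw [coeff_one]
  rcases lt_trichotomy j 0 with hj | hj | hj
  · rw [isDifference_gaugeOp f j hj, if_neg hj.ne]
  · subst hj
    rw [if_pos rfl]
    exact coeff_gaugeOp_top f n (by simp [deltaWronskian])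
  · rw [orderLE_gaugeOp f j (by exact_mod_cast hj), if_neg hj.ne']

theorem laxOp_pow {m : ℕ} (f : Fin m → ℤ → K) (hf : ∀ n, deltaWronskian f n ≠ 0) (l : ℕ) :
    laxOp f ^ l = gaugeOp f * Delta ^ l * Ring.inverse (gaugeOp f) := by
  have hu := isUnit_gaugeOp f hf
  induction l with
  | zero => rw [pow_zero, pow_zero, mul_one, Ring.mul_inverse_cancel _ hu]
  | succ l ih =>
    rw [pow_succ, ih, laxOp]
    simp only [mul_assoc]
    rw [Ring.inverse_mul_cancel_left _ _ hu, pow_succ]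
    simp only [mul_assoc]

/-- `(L ^ k)₋ = ∑ T_m(Δ ^ k f_i) Δ⁻¹ g_i`. -/
theorem minus_laxOp_pow {m : ℕ} (f : Fin m → ℤ → K) (hf : ∀ n, deltaWronskian f n ≠ 0) (k : ℕ) :
    (laxOp f ^ k).minus
      = sumDeltaInv (fun i => (gaugeOp f).act ((fwdDiff (1 : ℤ))^[k] (f i))) (adjointBasis f) := by
  rw [laxOp_pow f hf]
  rcases Nat.eq_zero_or_pos m with rfl | hm
  · rw [gaugeOp_fin_zero, Ring.inverse_one, one_mul, mul_one,
      (isDifference_Delta_pow k).minus_eq_zero]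
    simp [sumDeltaInv]
  · rw [inverse_gaugeOp hm f hf,
      minus_mul_sumDeltaInv ((isDifference_gaugeOp f).mul (isDifference_Delta_pow k))]
    congr 1
    ext i : 1
    rw [act_mul (isDifference_gaugeOp f) (isDifference_Delta_pow k), act_Delta_pow]

/-- The equations defining the `g_i` make the product with the Casorati matrix of `f` unitriangular.
-/
theorem det_adjointBasis_ne_zero {m : ℕ} (f : Fin m → ℤ → K) (hf : ∀ n, deltaWronskian f n ≠ 0)
    (n : ℤ) :
    (Matrix.of fun i s : Fin m => adjointBasis f i (n - m + (s : ℕ))).det ≠ 0 := by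
  set G := Matrix.of fun i s : Fin m => adjointBasis f i (n - m + (s : ℕ)) with hG
  have hval : ∀ r s : Fin m, r ≤ s → (casorati f n * G) r s = if r = s then 1 else 0 := by
    intro r s hrs
    have hrs' : (r : ℕ) ≤ s := hrs
    have h1 := r.2
    have h2 := s.2
    have h := sum_mul_adjointBasis f hf (n - m + (s : ℕ)) (m + r - s - 1) (by omega)
    have e1 : n - m + (s : ℕ) + 1 + ((m + r - s - 1 : ℕ) : ℤ) = n + (r : ℕ) := by omega
    rw [e1] at h
    rw [Matrix.mul_apply]
    refine h.trans (if_congr ?_ rfl rfl)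
    rw [Fin.ext_iff]
    omega
  have hdet : (casorati f n * G).det = 1 := by
    rw [Matrix.det_of_isLowerTriangular]
    · exact Finset.prod_eq_one fun i _ => by rw [hval i i le_rfl, if_pos rfl]
    · intro i j hij
      have hij' : i < j := hij
      rw [hval i j hij'.le, if_neg hij'.ne]
  rw [Matrix.det_mul] at hdet
  exact right_ne_zero_of_mul_eq_one hdet

/-- The coefficients linking `n + 1 + r` to `n`, for `r < m`, form a Casorati system for the values
`ψ_i(n)`. -/
theorem eq_zero_of_sumDeltaInv_eq_zero {m : ℕ} (f : Fin m → ℤ → K)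
    (hf : ∀ n, deltaWronskian f n ≠ 0) (ψ : Fin m → ℤ → K) (h : sumDeltaInv f ψ = 0)
    (i : Fin m) (n : ℤ) : ψ i n = 0 := by
  have hv : (fun i => ψ i n) = 0 := by
    apply Matrix.eq_zero_of_mulVec_eq_zero (M := casorati f (n + 1))
    · rw [← deltaWronskian_eq_det_casorati]
      exact hf _
    · ext r
      have := congrArg (fun X : PseudoDiffOp K => X.coeff (-1 - (r : ℕ)) (n + 1 + (r : ℕ))) h
      simp only [coeff_sumDeltaInv, coeff_zero] at this
      rw [if_pos (by omega)] at this
      have e : n + 1 + (r : ℕ) + (-1 - (r : ℕ)) = n := by ring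
      rw [e] at this
      exact this
  exact congrFun hv i

/-- If `∑ h_i Δ⁻¹ g_i` is a sum of `M` terms `q_i Δ⁻¹ r_i`, the `(M + 1)`-Wronskians of the `h_i`
vanish. -/
theorem deltaWronskian_eq_zero_of_sumDeltaInv_eq {m M : ℕ} (f : Fin m → ℤ → K)
    (hf : ∀ n, deltaWronskian f n ≠ 0) (h : Fin m → ℤ → K) (q r : Fin M → ℤ → K)
    (heq : sumDeltaInv h (adjointBasis f) = sumDeltaInv q r) (ι : Fin (M + 1) → Fin m) (n : ℤ) :
    deltaWronskian (fun j => h (ι j)) n = 0 := by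
  rw [deltaWronskian_eq_det_casorati]
  set G := Matrix.of fun i s : Fin m => adjointBasis f i (n - m + (s : ℕ)) with hG
  have hGu : IsUnit G.det := isUnit_iff_ne_zero.2 (det_adjointBasis_ne_zero f hf n)
  set H : Matrix (Fin (M + 1)) (Fin m) K := Matrix.of fun a i => h i (n + (a : ℕ)) with hH
  set Q : Matrix (Fin (M + 1)) (Fin M) K := Matrix.of fun a i => q i (n + (a : ℕ)) with hQ
  set R : Matrix (Fin M) (Fin m) K := Matrix.of fun i s => r i (n - m + (s : ℕ)) with hR
  -- Entry `(a, s)` is the coefficient of `Λ ^ (s - m - a)` at `n + a`. The window of the `g_i` ends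
  -- at `n - 1`, so every exponent is negative and the kernels see all entries.
  have hmul : H * G = Q * R := by
    ext a s
    have := congrArg (fun X : PseudoDiffOp K => X.coeff (s - m - a : ℤ) (n + (a : ℕ))) heq
    simp only [coeff_sumDeltaInv] at this
    rw [if_pos (by have := s.2; omega), if_pos (by have := s.2; omega)] at this
    have e : n + (a : ℕ) + (s - m - a : ℤ) = n - m + (s : ℕ) := by ring
    rw [e] at this
    exact this
  have hH' : H = Q * (R * G⁻¹) := by
    rw [← Matrix.mul_assoc, ← hmul, Matrix.mul_nonsing_inv_cancel_right _ _ hGu]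
  have hsub : casorati (fun j => h (ι j)) n = Q * (R * G⁻¹).submatrix id ι := by
    have : casorati (fun j => h (ι j)) n = H.submatrix id ι := rfl
    rw [this, hH']
    rfl
  -- A matrix of size `M + 1` factoring through `K ^ M` has rank at most `M`.
  by_contra hne
  have h1 := Matrix.rank_of_isUnit _
    ((Matrix.isUnit_iff_isUnit_det _).2 (isUnit_iff_ne_zero.2 hne))
  rw [hsub] at h1
  have h2 := Matrix.rank_mul_le_left Q ((R * G⁻¹).submatrix id ι)
  have h3 := Matrix.rank_le_card_width Q
  rw [h1] at h2
  simp only [Fintype.card_fin] at h2 h3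
  omega

end Casorati

/-! ### Derivatives in one time: the Sato and Lax equations, eigenfunctions. -/

section OneTime

variable {𝕜 K : Type*} [RCLike 𝕜] [RCLike K] [NormedAlgebra 𝕜 K]

theorem analyticAt_det {p : ℕ} {A : 𝕜 → Matrix (Fin p) (Fin p) K} {s₀ : 𝕜}
    (h : ∀ i j, AnalyticAt 𝕜 (fun s => A s i j) s₀) : AnalyticAt 𝕜 (fun s => (A s).det) s₀ := by
  simp only [Matrix.det_apply']
  exact Finset.analyticAt_fun_sum _ fun σ _ =>
    analyticAt_const.fun_mul (Finset.analyticAt_fun_prod _ fun i _ => h _ _)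

theorem analyticAt_iterate_fwdDiff {u : 𝕜 → ℤ → K} {s₀ : 𝕜}
    (h : ∀ n, AnalyticAt 𝕜 (fun s => u s n) s₀) (r : ℕ) (n : ℤ) :
    AnalyticAt 𝕜 (fun s => (fwdDiff (1 : ℤ))^[r] (u s) n) s₀ := by
  induction r generalizing n with
  | zero => exact h n
  | succ r ih =>
    simp only [Function.iterate_succ_apply']
    exact (ih (n + 1)).fun_sub (ih n)

theorem hasDerivAt_iterate_fwdDiff {u : 𝕜 → ℤ → K} {v : ℤ → K} {s₀ : 𝕜}
    (h : ∀ n, HasDerivAt (fun s => u s n) (v n) s₀) (r : ℕ) (n : ℤ) :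
    HasDerivAt (fun s => (fwdDiff (1 : ℤ))^[r] (u s) n) ((fwdDiff (1 : ℤ))^[r] v n) s₀ := by
  induction r generalizing n with
  | zero => exact h n
  | succ r ih =>
    simp only [Function.iterate_succ_apply']
    exact (ih (n + 1)).fun_sub (ih n)

variable {m : ℕ} {F : Fin m → 𝕜 → ℤ → K} {s₀ : 𝕜}

theorem analyticAt_deltaWronskian (hF : ∀ i n, AnalyticAt 𝕜 (fun s => F i s n) s₀) (n : ℤ) :
    AnalyticAt 𝕜 (fun s => deltaWronskian (fun i => F i s) n) s₀ :=
  analyticAt_det fun r c => analyticAt_iterate_fwdDiff (hF c) r n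

theorem analyticAt_gaugeCoeff (hF : ∀ i n, AnalyticAt 𝕜 (fun s => F i s n) s₀) (n : ℤ)
    (hW : deltaWronskian (fun i => F i s₀) n ≠ 0) (i : Fin (m + 1)) :
    AnalyticAt 𝕜 (fun s => gaugeCoeff (fun i => F i s) i n) s₀ := by
  refine AnalyticAt.fun_div (analyticAt_det fun r c => ?_) (analyticAt_deltaWronskian hF n) hW
  refine Fin.lastCases ?_ (fun c => ?_) c
  · simpa using analyticAt_const
  · simpa using analyticAt_iterate_fwdDiff (hF c) r n

theorem analyticAt_coeff_gaugeOp (hF : ∀ i n, AnalyticAt 𝕜 (fun s => F i s n) s₀)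
    (hW : ∀ n, deltaWronskian (fun i => F i s₀) n ≠ 0) (j n : ℤ) :
    AnalyticAt 𝕜 (fun s => (gaugeOp (fun i => F i s)).coeff j n) s₀ := by
  simp only [coeff_gaugeOp]
  exact Finset.analyticAt_fun_sum _ fun i _ =>
    (analyticAt_gaugeCoeff hF n (hW n) i).fun_mul analyticAt_const

theorem analyticAt_adjointBasis (hF : ∀ i n, AnalyticAt 𝕜 (fun s => F i s n) s₀)
    (hW : ∀ n, deltaWronskian (fun i => F i s₀) n ≠ 0) (i : Fin m) (n : ℤ) :
    AnalyticAt 𝕜 (fun s => adjointBasis (fun i => F i s) i n) s₀ := by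
  have hC : ∀ r c, AnalyticAt 𝕜 (fun s => casorati (fun i => F i s) (n + 1) r c) s₀ :=
    fun r c => hF c _
  refine AnalyticAt.fun_div ?_ (analyticAt_det hC) ?_
  · simp only [Matrix.cramer_apply]
    refine analyticAt_det fun r c => ?_
    simp only [Matrix.updateCol_apply]
    split_ifs
    · exact analyticAt_const
    · exact analyticAt_const
    · exact hC r c
  · rw [← deltaWronskian_eq_det_casorati]
    exact hW _

theorem analyticAt_gaugeOp_act (hF : ∀ i n, AnalyticAt 𝕜 (fun s => F i s n) s₀)
    (hW : ∀ n, deltaWronskian (fun i => F i s₀) n ≠ 0) {u : 𝕜 → ℤ → K}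
    (hu : ∀ n, AnalyticAt 𝕜 (fun s => u s n) s₀) (n : ℤ) :
    AnalyticAt 𝕜 (fun s => (gaugeOp (fun i => F i s)).act (u s) n) s₀ := by
  simp only [gaugeOp_act_eq_sum]
  exact Finset.analyticAt_fun_sum _ fun j _ =>
    (analyticAt_coeff_gaugeOp hF hW _ _).fun_mul (hu _)

/-- Coefficientwise derivative of a one-parameter family of operators. -/
def HasOpDerivAt (A : 𝕜 → PseudoDiffOp K) (A' : PseudoDiffOp K) (s₀ : 𝕜) : Prop :=
  ∀ j n, HasDerivAt (fun s => (A s).coeff j n) (A'.coeff j n) s₀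

namespace HasOpDerivAt

variable {A B : 𝕜 → PseudoDiffOp K} {A' B' : PseudoDiffOp K} {a b : ℤ}

theorem unique {A'' : PseudoDiffOp K} (h : HasOpDerivAt A A' s₀) (h' : HasOpDerivAt A A'' s₀) :
    A' = A'' := by
  ext j n
  exact (h j n).unique (h' j n)

theorem congr (h : HasOpDerivAt A A' s₀) (hAB : ∀ᶠ s in 𝓝 s₀, B s = A s) :
    HasOpDerivAt B A' s₀ := fun j n =>
  (h j n).congr_of_eventuallyEq (hAB.mono fun _ hs => congrArg (fun X => X.coeff j n) hs)

theorem const (X : PseudoDiffOp K) : HasOpDerivAt (fun _ => X) 0 s₀ :=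
  fun _ _ => hasDerivAt_const _ _

theorem orderLE (h : HasOpDerivAt A A' s₀) (ha : ∀ᶠ s in 𝓝 s₀, (A s).OrderLE a) :
    A'.OrderLE a := fun j hj n =>
  (h j n).unique ((hasDerivAt_const s₀ (0 : K)).congr_of_eventuallyEq
    (ha.mono fun _ hs => hs j hj n))

theorem isDifference (h : HasOpDerivAt A A' s₀) (ha : ∀ᶠ s in 𝓝 s₀, (A s).IsDifference) :
    A'.IsDifference := fun j hj n =>
  (h j n).unique ((hasDerivAt_const s₀ (0 : K)).congr_of_eventuallyEq
    (ha.mono fun _ hs => hs j hj n))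

/-- Order bounds uniform near `s₀` give each coefficient of the product a fixed finite index set, so
the Leibniz rule applies term by term. -/
theorem mul (hA : HasOpDerivAt A A' s₀) (hB : HasOpDerivAt B B' s₀)
    (ha : ∀ᶠ s in 𝓝 s₀, (A s).OrderLE a) (hb : ∀ᶠ s in 𝓝 s₀, (B s).OrderLE b) :
    HasOpDerivAt (fun s => A s * B s) (A' * B s₀ + A s₀ * B') s₀ := by
  intro j n
  have h : HasDerivAt (fun s => ∑ i ∈ Finset.Icc (j - b) a,
        (A s).coeff i n * (B s).coeff (j - i) (n + i))
      (∑ i ∈ Finset.Icc (j - b) a, (A'.coeff i n * (B s₀).coeff (j - i) (n + i)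
        + (A s₀).coeff i n * B'.coeff (j - i) (n + i))) s₀ :=
    HasDerivAt.fun_sum fun i _ => (hA i n).fun_mul (hB _ _)
  rw [coeff_add, coeff_mul_eq (hA.orderLE ha) hb.self_of_nhds,
    coeff_mul_eq ha.self_of_nhds (hB.orderLE hb), ← Finset.sum_add_distrib]
  refine h.congr_of_eventuallyEq ?_
  filter_upwards [ha, hb] with s has hbs
  exact coeff_mul_eq has hbs j n

theorem exists_of_differentiableAt (ha : ∀ᶠ s in 𝓝 s₀, (A s).OrderLE a)
    (h : ∀ j n, DifferentiableAt 𝕜 (fun s => (A s).coeff j n) s₀) :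
    ∃ A', HasOpDerivAt A A' s₀ := by
  refine ⟨⟨fun j n => deriv (fun s => (A s).coeff j n) s₀, a, fun j hj n => ?_⟩,
    fun j n => (h j n).hasDerivAt⟩
  exact ((hasDerivAt_const s₀ (0 : K)).congr_of_eventuallyEq
    (ha.mono fun _ hs => hs j hj n)).deriv

end HasOpDerivAt

theorem sumDeltaInv_add_right {M : ℕ} (q r r' : Fin M → ℤ → K) :
    sumDeltaInv q (fun i n => r i n + r' i n) = sumDeltaInv q r + sumDeltaInv q r' := by
  ext j n
  simp only [coeff_add, coeff_sumDeltaInv, mul_add, Finset.sum_add_distrib]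
  split_ifs <;> simp

theorem HasOpDerivAt.sumDeltaInv {M : ℕ} {q r : Fin M → 𝕜 → ℤ → K} {q' r' : Fin M → ℤ → K}
    (hq : ∀ i n, HasDerivAt (fun s => q i s n) (q' i n) s₀)
    (hr : ∀ i n, HasDerivAt (fun s => r i s n) (r' i n) s₀) :
    HasOpDerivAt (fun s => sumDeltaInv (fun i => q i s) (fun i => r i s))
      (sumDeltaInv q' (fun i => r i s₀) + sumDeltaInv (fun i => q i s₀) r') s₀ := by
  intro j n
  simp only [coeff_add, coeff_sumDeltaInv]
  split_ifs
  · rw [← Finset.sum_add_distrib]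
    exact HasDerivAt.fun_sum fun i _ => (hq i n).fun_mul (hr i _)
  · rw [add_zero]
    exact hasDerivAt_const _ _

variable {l : ℕ}

/-- The Sato equation `∂ T_m / ∂ t_l = B_l T_m - T_m Δ ^ l`. -/
theorem hasOpDerivAt_gaugeOp (hFa : ∀ i n, AnalyticAt 𝕜 (fun s => F i s n) s₀)
    (hF : ∀ i n, HasDerivAt (fun s => F i s n) ((fwdDiff (1 : ℤ))^[l] (F i s₀) n) s₀)
    (hW : ∀ᶠ s in 𝓝 s₀, ∀ n, deltaWronskian (fun i => F i s) n ≠ 0) :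
    HasOpDerivAt (fun s => gaugeOp (fun i => F i s))
      ((laxOp (fun i => F i s₀) ^ l).plus * gaugeOp (fun i => F i s₀)
        - gaugeOp (fun i => F i s₀) * Delta ^ l) s₀ := by
  set T := gaugeOp (fun i => F i s₀) with hT
  set L := laxOp (fun i => F i s₀) with hL
  have hW₀ := hW.self_of_nhds
  have hu := isUnit_gaugeOp _ hW₀
  have hord : ∀ s, (gaugeOp (fun i => F i s)).OrderLE m := fun s => orderLE_gaugeOp _
  have hdiff : ∀ s, (gaugeOp (fun i => F i s)).IsDifference := fun s => isDifference_gaugeOp _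
  obtain ⟨T', hT'⟩ := HasOpDerivAt.exists_of_differentiableAt (Eventually.of_forall hord)
    fun j n => (analyticAt_coeff_gaugeOp hFa hW₀ j n).differentiableAt
  have hT'ord : T'.OrderLE m := hT'.orderLE (Eventually.of_forall hord)
  have hT'diff : T'.IsDifference := hT'.isDifference (Eventually.of_forall hdiff)
  -- `T` stays monic near `s₀`, so its derivative has order below `m`.
  have hT'top : ∀ n, T'.coeff m n = 0 := fun n =>
    (hT' m n).unique ((hasDerivAt_const s₀ (1 : K)).congr_of_eventuallyEq
      (hW.mono fun s hs => coeff_gaugeOp_top _ n (hs n)))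
  have hLT : L ^ l * T = T * Delta ^ l := by
    rw [hL, laxOp_pow _ hW₀, mul_assoc, Ring.inverse_mul_cancel _ hu, mul_one]
  have hX : T' - ((L ^ l).plus * T - T * Delta ^ l) = 0 := by
    refine eq_zero_of_act_eq_zero hW₀ (hT'diff.sub (((isDifference_plus _).mul (hdiff s₀)).sub
      ((hdiff s₀).mul (isDifference_Delta_pow l)))) ?_ ?_
    -- Since `T Δ ^ l = L ^ l T`, the right-hand side of Sato's equation is `-(L ^ l)₋ T`, also of
    -- order below `m`.
    · have e : (L ^ l).plus * T - T * Delta ^ l = -((L ^ l).minus * T) := by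
        rw [← hLT]
        conv_lhs => rw [← plus_add_minus (L ^ l)]
        rw [add_mul]
        have : ((L ^ l).plus + (L ^ l).minus).plus = (L ^ l).plus := by rw [plus_add_minus]
        rw [this]
        abel
      have hm : ((L ^ l).minus * T).OrderLE (m - 1) :=
        ((orderLE_minus _).mul (hord s₀)).mono (by omega)
      rw [e]
      intro j hj n
      rw [coeff_sub, coeff_neg, hm j hj, neg_zero, sub_zero]
      rcases eq_or_lt_of_le (show (m : ℤ) ≤ j by omega) with h | h
      · rw [← h, hT'top]
      · exact hT'ord j h n
    · intro i n
      rw [act_sub _ _ hT'diff (((isDifference_plus _).mul (hdiff s₀)).sub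
          ((hdiff s₀).mul (isDifference_Delta_pow l))),
        act_sub _ _ ((isDifference_plus _).mul (hdiff s₀))
          ((hdiff s₀).mul (isDifference_Delta_pow l)),
        act_mul (isDifference_plus _) (hdiff s₀), act_mul (hdiff s₀) (isDifference_Delta_pow l),
        act_Delta_pow]
      have h0 : T.act (F i s₀) = fun _ => 0 := funext fun n => gaugeOp_act_self _ i n
      rw [h0, act_zero, zero_sub, sub_neg_eq_add]
      have hN : (m : ℤ) ≤ ((m + 1 : ℕ) : ℤ) - 1 := by simp
      -- The product rule applied to `T(f_i) = 0`: both sides of Sato's equation take the same value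
      -- on `f_i`.
      have hd : HasDerivAt (fun s => (gaugeOp (fun i => F i s)).act (F i s) n)
          (T'.act (F i s₀) n + T.act ((fwdDiff (1 : ℤ))^[l] (F i s₀)) n) s₀ := by
        rw [act_eq_sum hT'diff (hT'ord.mono hN), act_eq_sum (hdiff s₀) ((hord s₀).mono hN),
          ← Finset.sum_add_distrib]
        refine HasDerivAt.congr_of_eventuallyEq ?_ (Eventually.of_forall fun s =>
          act_eq_sum (hdiff s) ((hord s).mono hN) _ _)
        exact HasDerivAt.fun_sum fun j _ => (hT' _ _).fun_mul (hF i _)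
      exact hd.unique ((hasDerivAt_const s₀ (0 : K)).congr_of_eventuallyEq
        (Eventually.of_forall fun s => gaugeOp_act_self _ i n))
  rw [← sub_eq_zero.1 hX]
  exact hT'

theorem orderLE_inverse_gaugeOp (f : Fin m → ℤ → K) (hf : ∀ n, deltaWronskian f n ≠ 0) :
    (Ring.inverse (gaugeOp f)).OrderLE 0 := by
  rcases Nat.eq_zero_or_pos m with rfl | hm
  · rw [gaugeOp_fin_zero, Ring.inverse_one]
    exact fun j hj n => by rw [coeff_one, if_neg hj.ne']
  · rw [inverse_gaugeOp hm f hf]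
    exact fun j hj n => by rw [coeff_sumDeltaInv, if_neg (by omega)]

/-- Differentiability comes from the explicit form of the inverse; the value of the derivative comes
from differentiating `T T⁻¹ = 1`. -/
theorem hasOpDerivAt_inverse_gaugeOp (hFa : ∀ i n, AnalyticAt 𝕜 (fun s => F i s n) s₀)
    (hF : ∀ i n, HasDerivAt (fun s => F i s n) ((fwdDiff (1 : ℤ))^[l] (F i s₀) n) s₀)
    (hW : ∀ᶠ s in 𝓝 s₀, ∀ n, deltaWronskian (fun i => F i s) n ≠ 0) :
    HasOpDerivAt (fun s => Ring.inverse (gaugeOp (fun i => F i s)))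
      (Delta ^ l * Ring.inverse (gaugeOp (fun i => F i s₀))
        - Ring.inverse (gaugeOp (fun i => F i s₀)) * (laxOp (fun i => F i s₀) ^ l).plus) s₀ := by
  have hW₀ := hW.self_of_nhds
  have hu := isUnit_gaugeOp _ hW₀
  have hord : ∀ᶠ s in 𝓝 s₀, (Ring.inverse (gaugeOp (fun i => F i s))).OrderLE 0 :=
    hW.mono fun s hs => orderLE_inverse_gaugeOp _ hs
  obtain ⟨V', hV'⟩ :
      ∃ V', HasOpDerivAt (fun s => Ring.inverse (gaugeOp (fun i => F i s))) V' s₀ := by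
    rcases Nat.eq_zero_or_pos m with rfl | hm
    · refine ⟨0, (HasOpDerivAt.const 1).congr (Eventually.of_forall fun s => ?_)⟩
      rw [gaugeOp_fin_zero, Ring.inverse_one]
    · have hg := fun i n => (analyticAt_adjointBasis hFa hW₀ i n).differentiableAt.hasDerivAt
      exact ⟨_, (HasOpDerivAt.sumDeltaInv hF hg).congr
        (hW.mono fun s hs => inverse_gaugeOp hm _ hs)⟩
  have hT' := hasOpDerivAt_gaugeOp hFa hF hW
  have h1 := (hT'.mul hV' (Eventually.of_forall fun s => orderLE_gaugeOp _) hord).unique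
    ((HasOpDerivAt.const 1).congr
      (hW.mono fun s hs => Ring.mul_inverse_cancel _ (isUnit_gaugeOp _ hs)))
  set T := gaugeOp (fun i => F i s₀) with hT
  set V := Ring.inverse T with hV
  set B := (laxOp (fun i => F i s₀) ^ l).plus with hB
  have hVT : V * T = 1 := Ring.inverse_mul_cancel _ hu
  have hTV : T * V = 1 := Ring.mul_inverse_cancel _ hu
  have h2 : V' = Delta ^ l * V - V * B := by
    have e : V' = V * ((B * T - T * Delta ^ l) * V + T * V') - V * B * (T * V)
        + (V * T) * Delta ^ l * V := by
      have : V * (T * V') = V' := by rw [← mul_assoc, hVT, one_mul]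
      rw [mul_add, this]
      noncomm_ring
    rw [h1, hTV, hVT] at e
    rw [e]
    noncomm_ring
  rw [← h2]
  exact hV'

/-- The Lax equation `∂ L / ∂ t_l = [B_l, L]`. -/
theorem hasOpDerivAt_laxOp (hFa : ∀ i n, AnalyticAt 𝕜 (fun s => F i s n) s₀)
    (hF : ∀ i n, HasDerivAt (fun s => F i s n) ((fwdDiff (1 : ℤ))^[l] (F i s₀) n) s₀)
    (hW : ∀ᶠ s in 𝓝 s₀, ∀ n, deltaWronskian (fun i => F i s) n ≠ 0) :
    HasOpDerivAt (fun s => laxOp (fun i => F i s))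
      ((laxOp (fun i => F i s₀) ^ l).plus * laxOp (fun i => F i s₀)
        - laxOp (fun i => F i s₀) * (laxOp (fun i => F i s₀) ^ l).plus) s₀ := by
  have hW₀ := hW.self_of_nhds
  have hu := isUnit_gaugeOp _ hW₀
  have hΔ : (Delta : PseudoDiffOp K).OrderLE 1 := Delta_bound
  have hTo : ∀ᶠ s in 𝓝 s₀, (gaugeOp (fun i => F i s)).OrderLE m :=
    Eventually.of_forall fun s => orderLE_gaugeOp _
  have h := ((hasOpDerivAt_gaugeOp hFa hF hW).mul (HasOpDerivAt.const Delta) hTo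
    (Eventually.of_forall fun _ => hΔ)).mul (hasOpDerivAt_inverse_gaugeOp hFa hF hW)
    (hTo.mono fun s hs => hs.mul hΔ) (hW.mono fun s hs => orderLE_inverse_gaugeOp _ hs)
  convert h using 1
  · rfl
  set B := (laxOp (fun i => F i s₀) ^ l).plus with hB
  set T := gaugeOp (fun i => F i s₀) with hT
  set V := Ring.inverse T with hV
  have hL : laxOp (fun i => F i s₀) = T * Delta * V := rfl
  rw [hL]
  have hc : (Delta : PseudoDiffOp K) * Delta ^ l = Delta ^ l * Delta :=
    (pow_mul_comm' Delta l).symm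
  -- As `Δ` commutes with `Δ ^ l`, the terms with `Δ ^ l` from the derivatives of `T` and `T⁻¹`
  -- cancel.
  have : T * Delta * (Delta ^ l * V) = T * Delta ^ l * Delta * V := by
    rw [mul_assoc T Delta, ← mul_assoc Delta, hc]
    noncomm_ring
  rw [mul_sub, this]
  noncomm_ring

/-- `T_m(u)` is an eigenfunction if `∂ u / ∂ t_l = Δ ^ l u`. -/
theorem hasDerivAt_gaugeOp_act (hFa : ∀ i n, AnalyticAt 𝕜 (fun s => F i s n) s₀)
    (hF : ∀ i n, HasDerivAt (fun s => F i s n) ((fwdDiff (1 : ℤ))^[l] (F i s₀) n) s₀)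
    (hW : ∀ᶠ s in 𝓝 s₀, ∀ n, deltaWronskian (fun i => F i s) n ≠ 0) {u : 𝕜 → ℤ → K}
    (hu : ∀ n, HasDerivAt (fun s => u s n) ((fwdDiff (1 : ℤ))^[l] (u s₀) n) s₀) (n : ℤ) :
    HasDerivAt (fun s => (gaugeOp (fun i => F i s)).act (u s) n)
      ((laxOp (fun i => F i s₀) ^ l).plus.act ((gaugeOp (fun i => F i s₀)).act (u s₀)) n) s₀ := by
  have hT' := hasOpDerivAt_gaugeOp hFa hF hW
  have hdiff : ∀ s, (gaugeOp (fun i => F i s)).IsDifference := fun s => isDifference_gaugeOp _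
  have hord : ∀ s, (gaugeOp (fun i => F i s)).OrderLE m := fun s => orderLE_gaugeOp _
  have hN : (m : ℤ) ≤ ((m + 1 : ℕ) : ℤ) - 1 := by simp
  have hT'diff := hT'.isDifference (Eventually.of_forall hdiff)
  have hT'ord := hT'.orderLE (Eventually.of_forall hord)
  have e : (laxOp (fun i => F i s₀) ^ l).plus.act ((gaugeOp (fun i => F i s₀)).act (u s₀)) n
      = ((laxOp (fun i => F i s₀) ^ l).plus * gaugeOp (fun i => F i s₀)
        - gaugeOp (fun i => F i s₀) * Delta ^ l).act (u s₀) n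
        + (gaugeOp (fun i => F i s₀)).act ((fwdDiff (1 : ℤ))^[l] (u s₀)) n := by
    rw [act_sub _ _ ((isDifference_plus _).mul (hdiff s₀))
        ((hdiff s₀).mul (isDifference_Delta_pow l)), act_mul (isDifference_plus _) (hdiff s₀),
      act_mul (hdiff s₀) (isDifference_Delta_pow l), act_Delta_pow, sub_add_cancel]
  rw [e, act_eq_sum hT'diff (hT'ord.mono hN), act_eq_sum (hdiff s₀) ((hord s₀).mono hN),
    ← Finset.sum_add_distrib]
  refine HasDerivAt.congr_of_eventuallyEq ?_ (Eventually.of_forall fun s =>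
    act_eq_sum (hdiff s) ((hord s).mono hN) _ _)
  exact HasDerivAt.fun_sum fun j _ => (hT' _ _).fun_mul (hu _)

/-- The functions `adjointBasis` are adjoint eigenfunctions. -/
theorem hasDerivAt_adjointBasis (hFa : ∀ i n, AnalyticAt 𝕜 (fun s => F i s n) s₀)
    (hF : ∀ i n, HasDerivAt (fun s => F i s n) ((fwdDiff (1 : ℤ))^[l] (F i s₀) n) s₀)
    (hW : ∀ᶠ s in 𝓝 s₀, ∀ n, deltaWronskian (fun i => F i s) n ≠ 0) (i : Fin m) (n : ℤ) :
    HasDerivAt (fun s => adjointBasis (fun i => F i s) i n)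
      (-(laxOp (fun i => F i s₀) ^ l).plus.adjointAct (adjointBasis (fun i => F i s₀) i) n) s₀ := by
  have hW₀ := hW.self_of_nhds
  have hm : 0 < m := i.pos
  have hg := fun i n => (analyticAt_adjointBasis hFa hW₀ i n).differentiableAt.hasDerivAt
  -- Two expressions for the derivative of `T⁻¹ = ∑ f_i Δ⁻¹ g_i`. In their negative parts the terms
  -- with `Δ ^ l f_i` cancel, leaving `∑ f_i Δ⁻¹ (∂g_i + B_l*(g_i)) = 0`.
  have h1 := ((HasOpDerivAt.sumDeltaInv hF hg).congr
    (hW.mono fun s hs => inverse_gaugeOp hm _ hs)).unique (hasOpDerivAt_inverse_gaugeOp hFa hF hW)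
  rw [inverse_gaugeOp hm _ hW₀] at h1
  have h2 := congrArg PseudoDiffOp.minus h1
  have hminus : ∀ q r : Fin m → ℤ → K, (sumDeltaInv q r).minus = sumDeltaInv q r := by
    intro q r
    ext j n
    rw [minus_coeff, coeff_sumDeltaInv]
    split_ifs <;> first | rfl | omega
  rw [minus_sub, minus_mul_sumDeltaInv (isDifference_Delta_pow l),
    minus_sumDeltaInv_mul (isDifference_plus _), minus_add, hminus, hminus] at h2
  simp only [act_Delta_pow] at h2
  have h3 : sumDeltaInv (fun i => F i s₀) (fun i n =>
      deriv (fun s => adjointBasis (fun i => F i s) i n) s₀ +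
      (laxOp (fun i => F i s₀) ^ l).plus.adjointAct (adjointBasis (fun i => F i s₀) i) n) = 0 := by
    rw [sumDeltaInv_add_right]
    rw [sub_eq_add_neg, add_right_inj] at h2
    exact eq_neg_iff_add_eq_zero.1 h2
  have h4 := eq_zero_of_sumDeltaInv_eq_zero _ hW₀ _ h3 i n
  rw [← eq_neg_iff_add_eq_zero.2 h4]
  exact hg i n

end OneTime

/-! ### Uniqueness and linear dependence for solutions of the linear flows. -/

section LinearFlow

variable {𝕜 K : Type*} [RCLike 𝕜] [RCLike K] [NormedAlgebra 𝕜 K] {x : 𝕜} {ρ : ℝ}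

theorem isPreconnected_rclike_ball (x : 𝕜) (ρ : ℝ) : IsPreconnected (Metric.ball x ρ) :=
  (convex_ball (E := 𝕜) x ρ).isPreconnected

theorem sum_mul_iterate_fwdDiff {ι : Type*} (s : Finset ι) (c : ι → K) (y : ι → ℤ → K) (r : ℕ)
    (n : ℤ) : (fwdDiff (1 : ℤ))^[r] (fun n => ∑ i ∈ s, c i * y i n) n
      = ∑ i ∈ s, c i * (fwdDiff (1 : ℤ))^[r] (y i) n := by
  simp only [← act_Delta_pow]
  exact act_sum_mul (isDifference_Delta_pow r) s c y n

/-- A solution of the linear flow `∂ u / ∂ t_l = Δ ^ l u` that vanishes for one value of the time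
vanishes for all. -/
theorem eq_zero_of_linearFlow {u : 𝕜 → ℤ → K} {l : ℕ}
    (hua : ∀ s ∈ Metric.ball x ρ, ∀ n, AnalyticAt 𝕜 (fun s => u s n) s)
    (hu : ∀ s ∈ Metric.ball x ρ, ∀ n,
      HasDerivAt (fun s => u s n) ((fwdDiff (1 : ℤ))^[l] (u s) n) s)
    {s₁ : 𝕜} (hs₁ : s₁ ∈ Metric.ball x ρ) (h0 : ∀ n, u s₁ n = 0) :
    ∀ s ∈ Metric.ball x ρ, ∀ n, u s n = 0 := by
  -- Every time derivative is a power of `Δ` applied to `u`, so all Taylor coefficients vanish at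
  -- `s₁`; the identity theorem does the rest.
  have hiter : ∀ (N : ℕ) (n : ℤ), ∀ s ∈ Metric.ball x ρ,
      iteratedDeriv N (fun s => u s n) s = (fwdDiff (1 : ℤ))^[N * l] (u s) n := by
    intro N n
    induction N with
    | zero => intro s _; simp
    | succ N ih =>
      intro s hs
      rw [iteratedDeriv_succ]
      have h1 : iteratedDeriv N (fun s => u s n) =ᶠ[𝓝 s]
          fun s => (fwdDiff (1 : ℤ))^[N * l] (u s) n :=
        eventually_of_mem (Metric.isOpen_ball.mem_nhds hs) ih
      rw [h1.deriv_eq, (hasDerivAt_iterate_fwdDiff (hu s hs) (N * l) n).deriv,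
        ← Function.iterate_add_apply, Nat.succ_mul]
  intro s hs n
  refine AnalyticOnNhd.eqOn_zero_of_preconnected_of_eventuallyEq_zero
    (fun s hs => hua s hs n) (isPreconnected_rclike_ball x ρ) hs₁ ?_ hs
  refine analyticOrderAt_eq_top.1 ?_
  rw [ENat.eq_top_iff_forall_ge]
  intro N
  rw [natCast_le_analyticOrderAt_iff_iteratedDeriv_eq_zero (hua s₁ hs₁ n)]
  intro i _
  -- The zero sequence is written as an empty combination so that linearity of the iterated
  -- difference applies.
  rw [hiter i n s₁ hs₁, show u s₁ = fun n => ∑ i ∈ (∅ : Finset ℕ), (0 : K) * 0 from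
    funext fun n => by simp [h0], sum_mul_iterate_fwdDiff (y := fun _ _ => 0)]
  simp

theorem hasDerivAt_sum_const_mul {ι : Type*} (s : Finset ι) (c : ι → K) {y : ι → 𝕜 → K}
    {y' : ι → K} {z : 𝕜} (h : ∀ i, HasDerivAt (y i) (y' i) z) :
    HasDerivAt (fun s' => ∑ i ∈ s, c i * y i s') (∑ i ∈ s, c i * y' i) z :=
  HasDerivAt.fun_sum fun i _ => (h i).const_mul (c i)

theorem analyticAt_sum_const_mul {ι : Type*} (s : Finset ι) (c : ι → K) {y : ι → 𝕜 → K} {z : 𝕜}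
    (h : ∀ i, AnalyticAt 𝕜 (y i) z) : AnalyticAt 𝕜 (fun s' => ∑ i ∈ s, c i * y i s') z :=
  Finset.analyticAt_fun_sum _ fun i _ => analyticAt_const.fun_mul (h i)

/-- A linear relation at `n` between solutions of the flow `∂ y / ∂ t_1 = Δ y` propagates to
`n' ≥ n`. -/
theorem sum_eq_zero_of_le {p : ℕ} {y : Fin p → 𝕜 → ℤ → K}
    (hy : ∀ i, ∀ s ∈ Metric.ball x ρ, ∀ n,
      HasDerivAt (fun s => y i s n) (fwdDiff (1 : ℤ) (y i s) n) s)
    {n : ℤ} {c : Fin p → K} (h : ∀ s ∈ Metric.ball x ρ, ∑ i, c i * y i s n = 0) {n' : ℤ}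
    (hn : n ≤ n') : ∀ s ∈ Metric.ball x ρ, ∑ i, c i * y i s n' = 0 := by
  induction n', hn using Int.leInduction with
  | base => exact h
  | succ n' _ ih =>
    intro s hs
    -- Differentiating the relation at `n'` gives the relation for the differences, hence the one at
    -- `n' + 1`.
    have h1 := hasDerivAt_sum_const_mul Finset.univ c fun i => hy i s hs n'
    have h2 := h1.unique ((hasDerivAt_const s (0 : K)).congr_of_eventuallyEq
      (eventually_of_mem (Metric.isOpen_ball.mem_nhds hs) ih))
    simp only [fwdDiff, mul_sub, Finset.sum_sub_distrib, ih s hs, sub_zero] at h2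
    exact h2

/-- Solutions of the flow `∂ y / ∂ t_1 = Δ y` whose `Δ`-Wronskian vanishes at `n` are linearly
dependent at `n`. -/
theorem exists_sum_eq_zero_of_deltaWronskian {p : ℕ} {y : Fin p → 𝕜 → ℤ → K} (hρ : 0 < ρ)
    (hya : ∀ i, ∀ s ∈ Metric.ball x ρ, ∀ n, AnalyticAt 𝕜 (fun s => y i s n) s)
    (hy : ∀ i, ∀ s ∈ Metric.ball x ρ, ∀ n,
      HasDerivAt (fun s => y i s n) (fwdDiff (1 : ℤ) (y i s) n) s)
    (n : ℤ) (hW : ∀ s ∈ Metric.ball x ρ, deltaWronskian (fun i => y i s) n = 0) :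
    ∃ c : Fin p → K, c ≠ 0 ∧ ∀ s ∈ Metric.ball x ρ, ∑ i, c i * y i s n = 0 := by
  induction p with
  | zero => exact absurd (hW x (Metric.mem_ball_self hρ)) (by simp [deltaWronskian])
  | succ p ih =>
    -- The classical Wronskian argument: either the first `p` functions already have vanishing
    -- Wronskian, or near a point where it is nonzero the last function is a combination of them.
    by_cases hP : ∀ s ∈ Metric.ball x ρ, deltaWronskian (fun i : Fin p => y i.castSucc s) n = 0
    · obtain ⟨c, hc, hsum⟩ := ih (fun i => hya _) (fun i => hy _) hP
      refine ⟨Fin.snoc c 0, fun h => hc ?_, fun s hs => ?_⟩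
      · ext i
        simpa using congrFun h i.castSucc
      · rw [Fin.sum_univ_castSucc]
        simpa using hsum s hs
    · push Not at hP
      obtain ⟨s₁, hs₁, hne⟩ := hP
      set P : 𝕜 → Matrix (Fin p) (Fin p) K := fun s =>
        Matrix.of fun r c => (fwdDiff (1 : ℤ))^[(r : ℕ)] (y c.castSucc s) n with hPdef
      set Q : 𝕜 → Fin p → K := fun s r =>
        (fwdDiff (1 : ℤ))^[(r : ℕ)] (y (Fin.last p) s) n with hQdef
      set α : Fin p → 𝕜 → K := fun c s => Matrix.cramer (P s) (Q s) c / (P s).det with hα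
      have hPa : ∀ s ∈ Metric.ball x ρ, ∀ r c, AnalyticAt 𝕜 (fun s => P s r c) s :=
        fun s hs r c => analyticAt_iterate_fwdDiff (hya _ s hs) _ _
      have hdetP : ContinuousAt (fun s => (P s).det) s₁ :=
        (analyticAt_det (hPa s₁ hs₁)).continuousAt
      obtain ⟨ε, hε, hball⟩ := Metric.eventually_nhds_iff_ball.1
        ((hdetP.eventually_ne hne).and (Metric.isOpen_ball.mem_nhds hs₁))
      have hαa : ∀ s ∈ Metric.ball s₁ ε, ∀ c, DifferentiableAt 𝕜 (α c) s := by
        intro s hs c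
        have hs' := (hball s hs).2
        refine (AnalyticAt.fun_div ?_ (analyticAt_det (hPa s hs'))
          (hball s hs).1).differentiableAt
        simp only [Matrix.cramer_apply]
        refine analyticAt_det fun r c' => ?_
        simp only [Matrix.updateCol_apply]
        split_ifs
        · exact analyticAt_iterate_fwdDiff (hya _ s hs') _ _
        · exact hPa s hs' r c'
      -- Cramer's rule solves only the rows `r < p`. The vanishing of the full Wronskian supplies
      -- row `p`, which is what makes the coefficients constant.
      have hrel : ∀ s ∈ Metric.ball s₁ ε, ∀ r < p + 1,
          ∑ c : Fin p, (fwdDiff (1 : ℤ))^[r] (y c.castSucc s) n * α c s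
            = (fwdDiff (1 : ℤ))^[r] (y (Fin.last p) s) n := by
        intro s hs
        have hd := (hball s hs).1
        obtain ⟨v, hv, hvz⟩ := Matrix.exists_mulVec_eq_zero_iff.2 (hW s (hball s hs).2)
        have hrow : ∀ r < p + 1,
            ∑ c : Fin p, (fwdDiff (1 : ℤ))^[r] (y c.castSucc s) n * v c.castSucc
              + (fwdDiff (1 : ℤ))^[r] (y (Fin.last p) s) n * v (Fin.last p) = 0 := by
          intro r hr
          have := congrFun hvz ⟨r, hr⟩
          rw [Matrix.mulVec, dotProduct, Fin.sum_univ_castSucc] at this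
          exact this
        have hlast : v (Fin.last p) ≠ 0 := by
          intro h0
          have : (fun c : Fin p => v c.castSucc) = 0 := by
            apply Matrix.eq_zero_of_mulVec_eq_zero hd
            ext r
            have := hrow r (by omega)
            rw [h0, mul_zero, add_zero] at this
            exact this
          apply hv
          ext i
          refine Fin.lastCases h0 (fun c => congrFun this c) i
        have hβ : ∀ r < p + 1,
            ∑ c : Fin p, (fwdDiff (1 : ℤ))^[r] (y c.castSucc s) n *
              (-v c.castSucc / v (Fin.last p))
              = (fwdDiff (1 : ℤ))^[r] (y (Fin.last p) s) n := by
          intro r hr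
          simp only [mul_div_assoc', mul_neg]
          rw [← Finset.sum_div, Finset.sum_neg_distrib, div_eq_iff hlast]
          linear_combination -(hrow r hr)
        have hαβ : (fun c => α c s) = fun c => -v c.castSucc / v (Fin.last p) := by
          have h1 : (P s).mulVec (fun c => α c s) = Q s := by
            have := Matrix.mulVec_cramer (P s) (Q s)
            have e : (fun c => α c s) = (P s).det⁻¹ • Matrix.cramer (P s) (Q s) := by
              ext c
              simp [hα, div_eq_inv_mul]
            rw [e, Matrix.mulVec_smul, this, smul_smul, inv_mul_cancel₀ hd, one_smul]
          have h2 : (P s).mulVec (fun c => -v c.castSucc / v (Fin.last p)) = Q s := by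
            ext r
            exact hβ r (by omega)
          rw [← sub_eq_zero]
          apply Matrix.eq_zero_of_mulVec_eq_zero hd
          rw [Matrix.mulVec_sub, h1, h2, sub_self]
        intro r hr
        rw [← hβ r hr]
        exact Finset.sum_congr rfl fun c _ => by rw [congrFun hαβ c]
      -- Differentiating row `r` and subtracting row `r + 1` leaves `P α' = 0` with `P` invertible.
      have hα' : ∀ s ∈ Metric.ball s₁ ε, ∀ c, deriv (α c) s = 0 := by
        intro s hs c
        have hs' := (hball s hs).2
        have hz : (fun c => deriv (α c) s) = 0 := by
          apply Matrix.eq_zero_of_mulVec_eq_zero (hball s hs).1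
          ext r
          have hd1 : ∀ i, HasDerivAt (fun s => (fwdDiff (1 : ℤ))^[(r : ℕ)] (y i s) n)
              ((fwdDiff (1 : ℤ))^[(r : ℕ) + 1] (y i s) n) s := fun i =>
            hasDerivAt_iterate_fwdDiff (hy i s hs') r n
          have hd2 : HasDerivAt
              (fun s => ∑ c : Fin p, (fwdDiff (1 : ℤ))^[(r : ℕ)] (y c.castSucc s) n * α c s)
              (∑ c : Fin p, ((fwdDiff (1 : ℤ))^[(r : ℕ) + 1] (y c.castSucc s) n * α c s
                + (fwdDiff (1 : ℤ))^[(r : ℕ)] (y c.castSucc s) n * deriv (α c) s)) s :=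
            HasDerivAt.fun_sum fun c _ => (hd1 _).fun_mul (hαa s hs c).hasDerivAt
          have hd3 := hd2.unique ((hd1 (Fin.last p)).congr_of_eventuallyEq
            (eventually_of_mem (Metric.isOpen_ball.mem_nhds hs) fun s hs =>
              hrel s hs r (by omega)))
          rw [Finset.sum_add_distrib, hrel s hs (r + 1) (by omega), add_eq_left] at hd3
          exact hd3
        exact congrFun hz c
      have hconst : ∀ s ∈ Metric.ball s₁ ε, ∀ c, α c s = α c s₁ := fun s hs c =>
        Metric.isOpen_ball.is_const_of_deriv_eq_zero (isPreconnected_rclike_ball s₁ ε)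
          (fun s hs => (hαa s hs c).differentiableWithinAt) (fun s hs => hα' s hs c) hs
          (Metric.mem_ball_self hε)
      refine ⟨Fin.snoc (fun c => α c s₁) (-1), fun h => ?_, ?_⟩
      · simpa using congrFun h (Fin.last p)
      -- The relation holds near `s₁` and extends to the whole ball by the identity theorem.
      · refine AnalyticOnNhd.eqOn_zero_of_preconnected_of_eventuallyEq_zero
          (fun s hs => analyticAt_sum_const_mul _ _ fun i => hya i s hs n)
          (isPreconnected_rclike_ball x ρ) hs₁
          (eventually_of_mem (Metric.ball_mem_nhds s₁ hε) fun s hs => ?_)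
        have := hrel s hs 0 (by omega)
        simp only [Function.iterate_zero, id] at this
        simp only [Fin.sum_univ_castSucc, Fin.snoc_castSucc, Fin.snoc_last, Pi.zero_apply]
        rw [← this, neg_one_mul, ← sub_eq_add_neg, sub_eq_zero]
        exact Finset.sum_congr rfl fun c _ => by rw [hconst s hs c, mul_comm]

end LinearFlow

/-! ### The kernel of the gauge operator; linear relations and factorizations. -/

section LinearAlgebra

variable {K : Type*} [Field K]

/-- A sequence annihilated by the gauge operator is a combination of the `f_i`. -/
theorem exists_eq_sum_of_gaugeOp_act_eq_zero {m : ℕ} (f : Fin m → ℤ → K)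
    (hf : ∀ n, deltaWronskian f n ≠ 0) (φ : ℤ → K) (h : ∀ n, (gaugeOp f).act φ n = 0) :
    ∃ d : Fin m → K, ∀ n, φ n = ∑ i, d i * f i n := by
  have hdet : ∀ n, (casorati f n).det ≠ 0 := fun n => by
    rw [← deltaWronskian_eq_det_casorati]
    exact hf n
  -- On each window of length `m` the Casorati matrix determines the coefficients. The monic
  -- recurrence `T(φ) = 0` extends them one step to the right, so neighbouring windows share the
  -- same coefficients.
  have hex : ∀ n, ∃ d : Fin m → K, ∀ r < m, φ (n + r) = ∑ i, d i * f i (n + r) := by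
    intro n
    refine ⟨(casorati f n)⁻¹.mulVec fun r : Fin m => φ (n + (r : ℕ)), fun r hr => ?_⟩
    have h1 : (casorati f n).mulVec ((casorati f n)⁻¹.mulVec fun r : Fin m => φ (n + (r : ℕ)))
        = fun r : Fin m => φ (n + (r : ℕ)) := by
      rw [Matrix.mulVec_mulVec, Matrix.mul_nonsing_inv _ (isUnit_iff_ne_zero.2 (hdet n)),
        Matrix.one_mulVec]
    have h2 := congrFun h1 ⟨r, hr⟩
    rw [Matrix.mulVec, dotProduct] at h2
    rw [← h2]
    exact Finset.sum_congr rfl fun i _ => mul_comm _ _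
  choose d hd using hex
  have hstep : ∀ n, φ (n + m) = ∑ i, d n i * f i (n + m) := by
    intro n
    have h1 : (gaugeOp f).act (fun n' => ∑ i, d n i * f i n') n = 0 := by
      rw [act_sum_mul (isDifference_gaugeOp f)]
      exact Finset.sum_eq_zero fun i _ => by rw [gaugeOp_act_self, mul_zero]
    have h2 := h n
    rw [← h1, gaugeOp_act_eq_sum, gaugeOp_act_eq_sum, Finset.sum_range_succ,
      Finset.sum_range_succ, coeff_gaugeOp_top f n (hf n), one_mul, one_mul,
      Finset.sum_congr rfl fun r hr => by rw [hd n r (Finset.mem_range.1 hr)]] at h2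
    exact add_left_cancel h2
  have hsucc : ∀ n, d (n + 1) = d n := by
    intro n
    rw [← sub_eq_zero]
    apply Matrix.eq_zero_of_mulVec_eq_zero (hdet (n + 1))
    ext r
    have h1 := hd (n + 1) r r.2
    have h2 : φ (n + 1 + (r : ℕ)) = ∑ i, d n i * f i (n + 1 + (r : ℕ)) := by
      rcases Nat.lt_or_ge ((r : ℕ) + 1) m with hr | hr
      · have := hd n (r + 1) hr
        push_cast at this
        rw [add_assoc, add_comm 1]
        exact this
      · have e : n + 1 + (r : ℕ) = n + m := by have := r.2; omega
        rw [e]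
        exact hstep n
    rw [h1] at h2
    rw [Matrix.mulVec, dotProduct, Pi.zero_apply, ← sub_eq_zero.2 h2, ← Finset.sum_sub_distrib]
    exact Finset.sum_congr rfl fun i _ => by
      simp only [casorati, Matrix.of_apply, Pi.sub_apply]
      ring
  have hconst : ∀ n, d n = d 0 := by
    intro n
    induction n using Int.induction_on with
    | zero => rfl
    | succ n ih => rw [hsucc, ih]
    | pred n ih => rw [← ih, ← hsucc (-(n : ℤ) - 1), sub_add_cancel]
  refine ⟨d 0, fun n => ?_⟩
  have := hstep (n - m)
  rwa [sub_add_cancel, hconst] at this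

variable (K) in
/-- The linear relations `∑ c_i h_i = 0` between vectors. -/
def linearRelations {V : Type*} [AddCommGroup V] [Module K V] {m : ℕ} (h : Fin m → V) :
    Submodule K (Fin m → K) :=
  LinearMap.ker (Fintype.linearCombination K h)

theorem mem_linearRelations {m : ℕ} {h : Fin m → ℤ → K} {c : Fin m → K} :
    c ∈ linearRelations K h ↔ ∀ n, ∑ i, c i * h i n = 0 := by
  rw [linearRelations, LinearMap.mem_ker, Fintype.linearCombination_apply, funext_iff]
  simp

/-- The quotient is isomorphic to the span of the `h_i`, which has a basis chosen among them; `M +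
1` elements of that basis, listed by increasing index, would contradict `hdep`. -/
theorem finrank_quotient_linearRelations_le {V : Type*} [AddCommGroup V] [Module K V] {m M : ℕ}
    (h : Fin m → V)
    (hdep : ∀ ι : Fin (M + 1) → Fin m, StrictMono ι → ¬ LinearIndependent K (h ∘ ι)) :
    Module.finrank K ((Fin m → K) ⧸ linearRelations K h) ≤ M := by
  rw [linearRelations, (LinearMap.quotKerEquivRange _).finrank_eq,
    Fintype.range_linearCombination]
  obtain ⟨κ, a, ha, hsp, hli⟩ := exists_linearIndependent' K h
  have : Fintype κ := Fintype.ofInjective a ha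
  rw [← hsp, finrank_span_eq_card hli]
  by_contra! hlt
  obtain ⟨S, hS, hcard⟩ := Finset.exists_subset_card_eq
    (s := Finset.univ.map ⟨a, ha⟩) (n := M + 1) (by rw [Finset.card_map, Finset.card_univ]; omega)
  have hmem : ∀ j, ∃ k, a k = S.orderEmbOfFin hcard j := fun j => by
    simpa using hS (S.orderEmbOfFin_mem hcard j)
  choose e he using hmem
  refine hdep (S.orderEmbOfFin hcard) (S.orderEmbOfFin hcard).strictMono ?_
  have hcomp : h ∘ S.orderEmbOfFin hcard = (h ∘ a) ∘ e := by
    ext j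
    simp [he]
  rw [hcomp]
  refine hli.comp e fun j j' hj => (S.orderEmbOfFin hcard).injective ?_
  rw [← he, ← he, hj]

/-- A map to a quotient of dimension at most `M` factors through `K ^ M`. -/
theorem exists_factorization_of_finrank_quotient_le {m M : ℕ} (R : Submodule K (Fin m → K))
    (hR : Module.finrank K ((Fin m → K) ⧸ R) ≤ M) :
    ∃ p : (Fin m → Fin M → K) × (Fin M → Fin m → K),
      ∀ i, (fun l => (Pi.single i 1 : Fin m → K) l - ∑ j, p.1 i j * p.2 j l) ∈ R := by
  obtain ⟨g, hg⟩ := finrank_le_iff_exists_linearMap.1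
    (hR.trans_eq (Module.finrank_fin_fun K (n := M)).symm)
  obtain ⟨g', hg'⟩ := g.exists_leftInverse_of_injective (LinearMap.ker_eq_bot.2 hg)
  -- `g` embeds the quotient in `K ^ M`, `g'` is a left inverse, and `σ j` lifts the image under
  -- `g'` of the `j`-th basis vector.
  choose σ hσ using fun j : Fin M => R.mkQ_surjective (g' (Pi.single j 1))
  refine ⟨⟨fun i => g (R.mkQ (Pi.single i 1)), σ⟩, fun i => ?_⟩
  refine (Submodule.Quotient.mk_eq_zero R).1 ?_
  rw [← Submodule.mkQ_apply]
  dsimp only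
  have e : (fun l => (Pi.single i 1 : Fin m → K) l - ∑ j, g (R.mkQ (Pi.single i 1)) j * σ j l)
      = (Pi.single i 1 : Fin m → K) - ∑ j, g (R.mkQ (Pi.single i 1)) j • σ j := by
    ext l
    simp [Finset.sum_apply]
  rw [e, map_sub, map_sum, sub_eq_zero]
  simp only [map_smul, hσ]
  have h1 : g' (g (R.mkQ (Pi.single i 1))) = R.mkQ (Pi.single i 1) :=
    LinearMap.congr_fun hg' _
  conv_lhs => rw [← h1, LinearMap.pi_apply_eq_sum_univ g']
  refine Finset.sum_congr rfl fun j _ => ?_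
  congr 2
  ext l
  simp [Pi.single_apply, eq_comm]

end LinearAlgebra

/-! ### From vanishing Wronskians to linear relations that persist in time. -/

section Flow

variable {𝕜 K : Type*} [RCLike 𝕜] [RCLike K] [NormedAlgebra 𝕜 K] {x : 𝕜} {ρ : ℝ} {m : ℕ}
  {F : Fin m → 𝕜 → ℤ → K}

/-- If the Wronskians of the `f_i` and `M + 1` of the `Δ ^ k f_i` vanish along the first flow, then
any `M + 1` of the functions `T_m(Δ ^ k f_i)` are linearly dependent. -/
theorem not_linearIndependent_of_deltaWronskian_append (hρ : 0 < ρ)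
    (hFa : ∀ i, ∀ s ∈ Metric.ball x ρ, ∀ n, AnalyticAt 𝕜 (fun s => F i s n) s)
    (hF : ∀ i, ∀ s ∈ Metric.ball x ρ, ∀ n,
      HasDerivAt (fun s => F i s n) (fwdDiff (1 : ℤ) (F i s) n) s)
    (hW : ∀ n, deltaWronskian (fun i => F i x) n ≠ 0) {p k : ℕ} (ι : Fin p → Fin m)
    (hWp : ∀ s ∈ Metric.ball x ρ, ∀ n, deltaWronskian (Fin.append (fun i => F i s)
      (fun j => (fwdDiff (1 : ℤ))^[k] (F (ι j) s))) n = 0) :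
    ¬ LinearIndependent K fun j =>
      (gaugeOp (fun i => F i x)).act ((fwdDiff (1 : ℤ))^[k] (F (ι j) x)) := by
  set T := gaugeOp (fun i => F i x) with hT
  set y : Fin (m + p) → 𝕜 → ℤ → K :=
    Fin.append F (fun j s => (fwdDiff (1 : ℤ))^[k] (F (ι j) s)) with hy
  have happ : ∀ s, (fun i => y i s) = Fin.append (fun i => F i s)
      (fun j => (fwdDiff (1 : ℤ))^[k] (F (ι j) s)) := by
    intro s
    ext i : 1
    refine Fin.addCases (fun i => ?_) (fun j => ?_) i <;> simp [hy]
  have hya : ∀ i, ∀ s ∈ Metric.ball x ρ, ∀ n, AnalyticAt 𝕜 (fun s => y i s n) s := by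
    intro i s hs n
    refine Fin.addCases (fun i => ?_) (fun j => ?_) i
    · simpa [hy] using hFa i s hs n
    · simpa [hy] using analyticAt_iterate_fwdDiff (hFa (ι j) s hs) k n
  have hyd : ∀ i, ∀ s ∈ Metric.ball x ρ, ∀ n,
      HasDerivAt (fun s => y i s n) (fwdDiff (1 : ℤ) (y i s) n) s := by
    intro i s hs n
    refine Fin.addCases (fun i => ?_) (fun j => ?_) i
    · simpa [hy] using hF i s hs n
    · have h := hasDerivAt_iterate_fwdDiff (hF (ι j) s hs) k n
      rw [← Function.iterate_succ_apply, Function.iterate_succ_apply'] at h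
      simpa [hy] using h
  -- Relations valid from `n` onwards. A relation found at `n` propagates only to the right, hence
  -- the half-line.
  set R : ℤ → Submodule K (Fin p → K) := fun n =>
    { carrier := {c | ∀ n' ≥ n, ∑ j, c j * T.act ((fwdDiff (1 : ℤ))^[k] (F (ι j) x)) n' = 0}
      add_mem' := fun {a b} ha hb n' hn' => by
        simp only [Pi.add_apply, add_mul, Finset.sum_add_distrib, ha n' hn', hb n' hn', add_zero]
      zero_mem' := fun n' _ => by simp
      smul_mem' := fun a c hc n' hn' => by
        simp only [Pi.smul_apply, smul_eq_mul, mul_assoc, ← Finset.mul_sum, hc n' hn', mul_zero] }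
    with hR
  have hRne : ∀ n, R n ≠ ⊥ := by
    intro n
    obtain ⟨c, hc, hsum⟩ := exists_sum_eq_zero_of_deltaWronskian hρ hya hyd n
      fun s hs => by rw [happ]; exact hWp s hs n
    have hrel : ∀ n' ≥ n, ∑ i, c (Fin.castAdd p i) * F i x n'
        + ∑ j, c (Fin.natAdd m j) * (fwdDiff (1 : ℤ))^[k] (F (ι j) x) n' = 0 := by
      intro n' hn'
      have := sum_eq_zero_of_le hyd hsum hn' x (Metric.mem_ball_self hρ)
      rw [Fin.sum_univ_add] at this
      simpa [hy] using this
    have hmem : (fun j => c (Fin.natAdd m j)) ∈ R n := by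
      intro n' hn'
      -- Applying `T` removes the `f_i` from the relation and turns `Δ ^ k f` into `h`.
      have h1 : T.act (fun n' => ∑ i, c (Fin.castAdd p i) * F i x n') n' = 0 := by
        rw [act_sum_mul (isDifference_gaugeOp _)]
        exact Finset.sum_eq_zero fun i _ => by
          rw [gaugeOp_act_self (fun i => F i x) i, mul_zero]
      rw [← act_sum_mul (isDifference_gaugeOp _), ← neg_zero, ← h1, gaugeOp_act_eq_sum,
        gaugeOp_act_eq_sum, ← Finset.sum_neg_distrib]
      refine Finset.sum_congr rfl fun r _ => ?_
      rw [← mul_neg]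
      congr 1
      exact (neg_eq_of_add_eq_zero_right (hrel (n' + r) (by omega))).symm
    -- If the remaining coefficients were all zero, `c` would be a relation among the `f_i` on a
    -- window of length `m`, against the nonvanishing Wronskian.
    intro hbot
    rw [hbot, Submodule.mem_bot] at hmem
    apply hc
    have hd : (fun i => c (Fin.castAdd p i)) = 0 := by
      apply Matrix.eq_zero_of_mulVec_eq_zero (M := casorati (fun i => F i x) n)
      · rw [← deltaWronskian_eq_det_casorati]
        exact hW n
      · ext r
        have h1 := hrel (n + (r : ℕ)) (by omega)
        have h2 : ∀ j, c (Fin.natAdd m j) = 0 := fun j => congrFun hmem j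
        simp only [h2, zero_mul, Finset.sum_const_zero, add_zero] at h1
        rw [Matrix.mulVec, dotProduct, Pi.zero_apply, ← h1]
        exact Finset.sum_congr rfl fun i _ => mul_comm _ _
    ext i
    refine Fin.addCases (fun i => congrFun hd i) (fun j => congrFun hmem j) i
  -- The nonzero spaces decrease as the half-line grows to the left, so they stabilise and share a
  -- nonzero relation.
  obtain ⟨N, hN⟩ := IsArtinian.monotone_stabilizes
    (⟨fun N : ℕ => OrderDual.toDual (R (-N)), fun a b hab c hc n' hn' => hc n' (by omega)⟩ :
      ℕ →o (Submodule K (Fin p → K))ᵒᵈ)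
  obtain ⟨c, hc, hc0⟩ := Submodule.exists_mem_ne_zero_of_ne_bot (hRne (-N))
  have hall : ∀ n, ∑ j, c j * T.act ((fwdDiff (1 : ℤ))^[k] (F (ι j) x)) n = 0 := by
    intro n
    have h1 : R (-N) = R (-((N + n.natAbs : ℕ) : ℤ)) := hN (N + n.natAbs) (by omega)
    rw [h1] at hc
    exact hc n (by omega)
  rw [Fintype.not_linearIndependent_iff]
  refine ⟨c, ?_, Function.ne_iff.1 hc0⟩
  ext n
  simpa using hall n

/-- The linear relations between the functions `T_m(Δ ^ k f_i)` do not depend on the time. -/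
theorem linearRelations_gaugeOp_act_le {l k : ℕ}
    (hFa : ∀ i, ∀ s ∈ Metric.ball x ρ, ∀ n, AnalyticAt 𝕜 (fun s => F i s n) s)
    (hF : ∀ i, ∀ s ∈ Metric.ball x ρ, ∀ n,
      HasDerivAt (fun s => F i s n) ((fwdDiff (1 : ℤ))^[l] (F i s) n) s)
    (hW : ∀ s ∈ Metric.ball x ρ, ∀ n, deltaWronskian (fun i => F i s) n ≠ 0)
    {s₁ s₂ : 𝕜} (hs₁ : s₁ ∈ Metric.ball x ρ) (hs₂ : s₂ ∈ Metric.ball x ρ) :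
    linearRelations K (fun i => (gaugeOp (fun i => F i s₁)).act ((fwdDiff (1 : ℤ))^[k] (F i s₁)))
      ≤ linearRelations K
        (fun i => (gaugeOp (fun i => F i s₂)).act ((fwdDiff (1 : ℤ))^[k] (F i s₂))) := by
  intro c hc
  rw [mem_linearRelations] at hc ⊢
  -- A relation among the `T(Δ ^ k f_i)` at `s₁` puts `∑ c_i Δ ^ k f_i` in the kernel of `T`. Its
  -- difference from `∑ d_i f_i` solves the linear flow and vanishes at `s₁`, hence also at `s₂`.
  obtain ⟨d, hd⟩ := exists_eq_sum_of_gaugeOp_act_eq_zero (fun i => F i s₁) (hW s₁ hs₁)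
    (fun n => ∑ i, c i * (fwdDiff (1 : ℤ))^[k] (F i s₁) n) fun n => by
      rw [act_sum_mul (isDifference_gaugeOp _)]
      exact hc n
  have hzero := eq_zero_of_linearFlow (l := l)
    (u := fun s n => ∑ i, (c i * (fwdDiff (1 : ℤ))^[k] (F i s) n - d i * F i s n))
    (fun s hs n => Finset.analyticAt_fun_sum _ fun i _ =>
      (analyticAt_const.fun_mul (analyticAt_iterate_fwdDiff (hFa i s hs) k n)).fun_sub
        (analyticAt_const.fun_mul (hFa i s hs n)))
    (fun s hs n => by
      have h1 : HasDerivAt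
          (fun s => ∑ i, (c i * (fwdDiff (1 : ℤ))^[k] (F i s) n - d i * F i s n))
          (∑ i, (c i * (fwdDiff (1 : ℤ))^[k] ((fwdDiff (1 : ℤ))^[l] (F i s)) n
            - d i * (fwdDiff (1 : ℤ))^[l] (F i s) n)) s :=
        HasDerivAt.fun_sum fun i _ =>
          ((hasDerivAt_iterate_fwdDiff (hF i s hs) k n).const_mul (c i)).fun_sub
            ((hF i s hs n).const_mul (d i))
      convert h1 using 1
      rw [← act_Delta_pow]
      simp only [Finset.sum_sub_distrib]
      -- The difference is written as a two-term combination with coefficients `1` and `-1`, to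
      -- which linearity of the action applies.
      have e : (fun n => ∑ i, c i * (fwdDiff (1 : ℤ))^[k] (F i s) n - ∑ i, d i * F i s n)
          = fun n => ∑ b : Bool, (cond b 1 (-1) : K) *
            (cond b (fun n => ∑ i, c i * (fwdDiff (1 : ℤ))^[k] (F i s) n)
              (fun n => ∑ i, d i * F i s n) : ℤ → K) n := by
        ext n
        simp [sub_eq_add_neg]
      rw [e, act_sum_mul (isDifference_Delta_pow l)]
      simp only [act_Delta_pow, Fintype.sum_bool, cond_true, cond_false, one_mul, neg_one_mul,
        ← sub_eq_add_neg]
      rw [sum_mul_iterate_fwdDiff, sum_mul_iterate_fwdDiff]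
      simp only [← Function.iterate_add_apply, add_comm])
    hs₁ (fun n => by rw [Finset.sum_sub_distrib, hd n, sub_self]) s₂ hs₂
  intro n
  rw [← act_sum_mul (isDifference_gaugeOp _)]
  have e : (fun n => ∑ i, c i * (fwdDiff (1 : ℤ))^[k] (F i s₂) n)
      = fun n => ∑ i, d i * F i s₂ n := by
    ext n
    have := hzero n
    rwa [Finset.sum_sub_distrib, sub_eq_zero] at this
  rw [e, act_sum_mul (isDifference_gaugeOp _)]
  exact Finset.sum_eq_zero fun i _ => by rw [gaugeOp_act_self (fun i => F i s₂) i, mul_zero]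

end Flow

theorem eventually_deltaWronskian_ne_zero {𝕜 K : Type*} [RCLike 𝕜] [Field K] {D : Set (ℕ+ → 𝕜)}
    (hD : IsTimeDomain D) {m : ℕ} {f : Fin m → (ℕ+ → 𝕜) → ℤ → K}
    (hτ : ∀ t ∈ D, ∀ n : ℤ, deltaWronskian (fun i => f i t) n ≠ 0) {t : ℕ+ → 𝕜} (ht : t ∈ D)
    (l : ℕ+) : ∀ᶠ s in 𝓝 (t l), ∀ n,
      deltaWronskian (fun i => f i (Function.update t l s)) n ≠ 0 :=
  (hD t ht l).mono fun _ hs => hτ _ hs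

/-! ### Transfer from one time to the whole time domain. -/

section Times

variable {𝕜 K : Type*} [RCLike 𝕜] [RCLike K] [NormedAlgebra 𝕜 K] {D : Set (ℕ+ → 𝕜)}

theorem IsTimeAnalyticOn.analyticAt_update {u : (ℕ+ → 𝕜) → ℤ → K} (hu : IsTimeAnalyticOn D u)
    {t : ℕ+ → 𝕜} {l : ℕ+} {s : 𝕜} (hs : Function.update t l s ∈ D) (n : ℤ) :
    AnalyticAt 𝕜 (fun s => u (Function.update t l s) n) s := by
  simpa using hu _ hs n l

theorem IsLinearFlowOn.hasDerivAt_update {u : (ℕ+ → 𝕜) → ℤ → K} (hu : IsLinearFlowOn D u)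
    {t : ℕ+ → 𝕜} {l : ℕ+} {s : 𝕜} (hs : Function.update t l s ∈ D) (n : ℤ) :
    HasDerivAt (fun s => u (Function.update t l s) n)
      ((fwdDiff (1 : ℤ))^[(l : ℕ)] (u (Function.update t l s)) n) s := by
  simpa [HasTimeDerivAt] using hu _ hs n l

variable {m : ℕ} {f : Fin m → (ℕ+ → 𝕜) → ℤ → K}

/-- The Lax operator solves the discrete KP hierarchy. -/
theorem isLaxSolutionOn_laxOp (hD : IsTimeDomain D) (hfa : ∀ i, IsTimeAnalyticOn D (f i))
    (hflow : ∀ i, IsLinearFlowOn D (f i))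
    (hτ : ∀ t ∈ D, ∀ n : ℤ, deltaWronskian (fun i => f i t) n ≠ 0) :
    IsLaxSolutionOn D (fun t => laxOp (fun i => f i t)) := by
  intro t ht l j n
  have hs : Function.update t l (t l) ∈ D := by rwa [Function.update_eq_self]
  have h := hasOpDerivAt_laxOp (F := fun i s => f i (Function.update t l s)) (s₀ := t l)
    (fun i n => (hfa i).analyticAt_update hs n) (fun i n => (hflow i).hasDerivAt_update hs n)
    (eventually_deltaWronskian_ne_zero hD hτ ht l) j n
  simp only [Function.update_eq_self] at h
  exact h

theorem isEigenfunctionOn_gaugeOp_act (hD : IsTimeDomain D) (hfa : ∀ i, IsTimeAnalyticOn D (f i))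
    (hflow : ∀ i, IsLinearFlowOn D (f i))
    (hτ : ∀ t ∈ D, ∀ n : ℤ, deltaWronskian (fun i => f i t) n ≠ 0) (k : ℕ) (i : Fin m) :
    IsEigenfunctionOn D (fun t => laxOp (fun i => f i t))
      (fun t => (gaugeOp (fun i => f i t)).act ((fwdDiff (1 : ℤ))^[k] (f i t))) := by
  intro t ht l n
  have hs : Function.update t l (t l) ∈ D := by rwa [Function.update_eq_self]
  have h := hasDerivAt_gaugeOp_act (F := fun i s => f i (Function.update t l s)) (s₀ := t l)
    (fun i n => (hfa i).analyticAt_update hs n) (fun i n => (hflow i).hasDerivAt_update hs n)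
    (eventually_deltaWronskian_ne_zero hD hτ ht l)
    (u := fun s => (fwdDiff (1 : ℤ))^[k] (f i (Function.update t l s))) (fun n => by
      have := hasDerivAt_iterate_fwdDiff (fun n => (hflow i).hasDerivAt_update hs n) k n
      rwa [← Function.iterate_add_apply, add_comm k, Function.iterate_add_apply] at this) n
  simp only [Function.update_eq_self] at h
  exact h

theorem isTimeAnalyticOn_gaugeOp_act (hfa : ∀ i, IsTimeAnalyticOn D (f i))
    (hτ : ∀ t ∈ D, ∀ n : ℤ, deltaWronskian (fun i => f i t) n ≠ 0) (k : ℕ) (i : Fin m) :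
    IsTimeAnalyticOn D
      (fun t => (gaugeOp (fun i => f i t)).act ((fwdDiff (1 : ℤ))^[k] (f i t))) := by
  intro t ht n l
  have hs : Function.update t l (t l) ∈ D := by rwa [Function.update_eq_self]
  exact analyticAt_gaugeOp_act (F := fun i s => f i (Function.update t l s))
    (fun i n => (hfa i).analyticAt_update hs n) (hτ _ hs)
    (fun n => analyticAt_iterate_fwdDiff (fun n => (hfa i).analyticAt_update hs n) k n) n

theorem isAdjointEigenfunctionOn_adjointBasis (hD : IsTimeDomain D)
    (hfa : ∀ i, IsTimeAnalyticOn D (f i)) (hflow : ∀ i, IsLinearFlowOn D (f i))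
    (hτ : ∀ t ∈ D, ∀ n : ℤ, deltaWronskian (fun i => f i t) n ≠ 0) (i : Fin m) :
    IsAdjointEigenfunctionOn D (fun t => laxOp (fun i => f i t))
      (fun t => adjointBasis (fun i => f i t) i) := by
  intro t ht l n
  have hs : Function.update t l (t l) ∈ D := by rwa [Function.update_eq_self]
  have h := hasDerivAt_adjointBasis (F := fun i s => f i (Function.update t l s)) (s₀ := t l)
    (fun i n => (hfa i).analyticAt_update hs n) (fun i n => (hflow i).hasDerivAt_update hs n)
    (eventually_deltaWronskian_ne_zero hD hτ ht l) i n
  simp only [Function.update_eq_self] at h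
  exact h

theorem isTimeAnalyticOn_adjointBasis (hfa : ∀ i, IsTimeAnalyticOn D (f i))
    (hτ : ∀ t ∈ D, ∀ n : ℤ, deltaWronskian (fun i => f i t) n ≠ 0) (i : Fin m) :
    IsTimeAnalyticOn D (fun t => adjointBasis (fun i => f i t) i) := by
  intro t ht n l
  have hs : Function.update t l (t l) ∈ D := by rwa [Function.update_eq_self]
  exact analyticAt_adjointBasis (F := fun i s => f i (Function.update t l s))
    (fun i n => (hfa i).analyticAt_update hs n) (hτ _ hs) i n

/-- The linear relations between the `T_m(Δ ^ k f_i)` are locally constant in each time. -/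
theorem eventually_linearRelations_eq (hD : IsTimeDomain D) (hfa : ∀ i, IsTimeAnalyticOn D (f i))
    (hflow : ∀ i, IsLinearFlowOn D (f i))
    (hτ : ∀ t ∈ D, ∀ n : ℤ, deltaWronskian (fun i => f i t) n ≠ 0) (k : ℕ)
    {R : (ℕ+ → 𝕜) → Submodule K (Fin m → K)}
    (hR : ∀ t, R t = linearRelations K
      (fun i => (gaugeOp (fun i => f i t)).act ((fwdDiff (1 : ℤ))^[k] (f i t))))
    {t : ℕ+ → 𝕜} (ht : t ∈ D) (l : ℕ+) : ∀ᶠ s in 𝓝 (t l), R (Function.update t l s) = R t := by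
  obtain ⟨ρ, hρ, hball⟩ := Metric.eventually_nhds_iff_ball.1 (hD t ht l)
  have h : ∀ s₁ ∈ Metric.ball (t l) ρ, ∀ s₂ ∈ Metric.ball (t l) ρ,
      R (Function.update t l s₁) ≤ R (Function.update t l s₂) := by
    intro s₁ hs₁ s₂ hs₂
    rw [hR, hR]
    exact linearRelations_gaugeOp_act_le (F := fun i s => f i (Function.update t l s))
      (l := (l : ℕ))
      (fun i s hs n => (hfa i).analyticAt_update (hball s hs) n)
      (fun i s hs n => (hflow i).hasDerivAt_update (hball s hs) n)
      (fun s hs => hτ _ (hball s hs)) hs₁ hs₂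
  filter_upwards [Metric.ball_mem_nhds (t l) hρ] with s hs
  have hself := Metric.mem_ball_self (x := t l) hρ
  have h1 := h s hs (t l) hself
  have h2 := h (t l) hself s hs
  rw [Function.update_eq_self] at h1 h2
  exact le_antisymm h1 h2

variable {ι : Type*} {c : (ℕ+ → 𝕜) → ι → K} {u : ι → (ℕ+ → 𝕜) → ℤ → K}

/-- Analyticity and derivatives in a single time see `c` only near one value of that time, so local
constancy suffices; `c` need not be constant on `D`. -/
theorem IsTimeAnalyticOn.sum_mul (S : Finset ι) (hu : ∀ i, IsTimeAnalyticOn D (u i))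
    (hc : ∀ t ∈ D, ∀ l : ℕ+, ∀ᶠ s in 𝓝 (t l), c (Function.update t l s) = c t) :
    IsTimeAnalyticOn D (fun t n => ∑ i ∈ S, c t i * u i t n) := by
  intro t ht n l
  refine (analyticAt_sum_const_mul S (c t) fun i => hu i t ht n l).congr ?_
  filter_upwards [hc t ht l] with s hs
  rw [hs]

theorem IsEigenfunctionOn.sum_mul {L : (ℕ+ → 𝕜) → PseudoDiffOp K} (S : Finset ι)
    (hu : ∀ i, IsEigenfunctionOn D L (u i))
    (hc : ∀ t ∈ D, ∀ l : ℕ+, ∀ᶠ s in 𝓝 (t l), c (Function.update t l s) = c t) :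
    IsEigenfunctionOn D L (fun t n => ∑ i ∈ S, c t i * u i t n) := by
  intro t ht l n
  rw [act_sum_mul (isDifference_plus _)]
  refine (hasDerivAt_sum_const_mul S (c t) fun i => hu i t ht l n).congr_of_eventuallyEq ?_
  filter_upwards [hc t ht l] with s hs
  rw [hs]

theorem IsAdjointEigenfunctionOn.sum_mul {L : (ℕ+ → 𝕜) → PseudoDiffOp K} (S : Finset ι)
    (hu : ∀ i, IsAdjointEigenfunctionOn D L (u i))
    (hc : ∀ t ∈ D, ∀ l : ℕ+, ∀ᶠ s in 𝓝 (t l), c (Function.update t l s) = c t) :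
    IsAdjointEigenfunctionOn D L (fun t n => ∑ i ∈ S, c t i * u i t n) := by
  intro t ht l n
  rw [adjointAct_sum_mul (isDifference_plus _), ← Finset.sum_neg_distrib]
  simp only [← mul_neg]
  refine (hasDerivAt_sum_const_mul S (c t) fun i => hu i t ht l n).congr_of_eventuallyEq ?_
  filter_upwards [hc t ht l] with s hs
  rw [hs]

end Times

/-- Modulo the relations `h_i = ∑ p_ij q_j` with `q_j = ∑ σ_jl h_l`; the constants `p_ij` pass
through `Δ⁻¹` and are absorbed into the right-hand functions. -/
theorem sumDeltaInv_eq_of_mem_linearRelations {K : Type*} [Field K] {m M : ℕ}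
    (h g : Fin m → ℤ → K) (p : Fin m → Fin M → K) (σ : Fin M → Fin m → K)
    (hp : ∀ i, (fun l => (Pi.single i 1 : Fin m → K) l - ∑ j, p i j * σ j l)
      ∈ linearRelations K h) :
    sumDeltaInv h g =
      sumDeltaInv (fun j n => ∑ i, σ j i * h i n) (fun j n => ∑ i, p i j * g i n) := by
  have hh : ∀ i n, h i n = ∑ j, p i j * ∑ l, σ j l * h l n := by
    intro i n
    have := mem_linearRelations.1 (hp i) n
    simp only [sub_mul, Finset.sum_sub_distrib, Pi.single_apply, ite_mul, one_mul, zero_mul,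
      Finset.sum_ite_eq', Finset.mem_univ, if_true] at this
    rw [sub_eq_zero.1 this]
    simp only [Finset.sum_mul, Finset.mul_sum]
    rw [Finset.sum_comm]
    simp only [mul_assoc]
  ext j n
  rw [coeff_sumDeltaInv, coeff_sumDeltaInv]
  split_ifs
  · calc ∑ i, h i n * g i (n + j)
        = ∑ i, (∑ a, p i a * ∑ l, σ a l * h l n) * g i (n + j) :=
          Finset.sum_congr rfl fun i _ => by rw [← hh i n]
      _ = _ := by
          simp only [Finset.sum_mul]
          rw [Finset.sum_comm]
          refine Finset.sum_congr rfl fun a _ => ?_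
          rw [← Finset.sum_mul, Finset.mul_sum]
          exact Finset.sum_congr rfl fun i _ => by ring
  · rfl

/-! ### The equivalence theorem. -/

theorem theorem2 {𝕜 K : Type*} [RCLike 𝕜] [RCLike K] [NormedAlgebra 𝕜 K]
    (D : Set (ℕ+ → 𝕜)) (hD : IsTimeDomain D) (m M k : ℕ) (hk : 1 ≤ k)
    (f : Fin m → (ℕ+ → 𝕜) → ℤ → K)
    (hfa : ∀ i, IsTimeAnalyticOn D (f i))
    (hflow : ∀ i, IsLinearFlowOn D (f i))
    (hτ : ∀ t ∈ D, ∀ n : ℤ, deltaWronskian (fun i => f i t) n ≠ 0) :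
    -- `L` is a solution of the discrete KP hierarchy
    IsLaxSolutionOn D (fun t => laxOp (fun i => f i t)) ∧
    -- the Wronskian identity
    (∀ ι : Fin (M + 1) → Fin m, StrictMono ι → ∀ t ∈ D, ∀ n : ℤ,
      deltaWronskian (Fin.append (fun i => f i t)
          (fun j => (fwdDiff (1 : ℤ))^[k] (f (ι j) t))) n
        = deltaWronskian (fun i => f i t) n *
          deltaWronskian (fun (j : Fin (M + 1)) (n' : ℤ) =>
            deltaWronskian (Fin.snoc (fun i => f i t) ((fwdDiff (1 : ℤ))^[k] (f (ι j) t)) :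
                Fin (m + 1) → ℤ → K) n'
              / deltaWronskian (fun i => f i t) n') n) ∧
    List.TFAE [
      -- the constraint, for some functions `q`, `r`
      ∃ q r : Fin M → (ℕ+ → 𝕜) → ℤ → K, ∀ t ∈ D,
        (laxOp (fun i => f i t) ^ k).minus = sumDeltaInv (fun i => q i t) (fun i => r i t),
      -- the constraint, for analytic eigenfunctions `q` and adjoint eigenfunctions `r`
      ∃ q r : Fin M → (ℕ+ → 𝕜) → ℤ → K,
        (∀ i, IsTimeAnalyticOn D (q i) ∧
          IsEigenfunctionOn D (fun t => laxOp (fun i => f i t)) (q i)) ∧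
        (∀ i, IsTimeAnalyticOn D (r i) ∧
          IsAdjointEigenfunctionOn D (fun t => laxOp (fun i => f i t)) (r i)) ∧
        ∀ t ∈ D,
          (laxOp (fun i => f i t) ^ k).minus = sumDeltaInv (fun i => q i t) (fun i => r i t),
      -- the vanishing of the `(m + M + 1)`-Wronskians
      ∀ ι : Fin (M + 1) → Fin m, StrictMono ι → ∀ t ∈ D, ∀ n : ℤ,
        deltaWronskian (Fin.append (fun i => f i t)
          (fun j => (fwdDiff (1 : ℤ))^[k] (f (ι j) t))) n = 0,
      -- the vanishing of the `(M + 1)`-Wronskians of the ratios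
      ∀ ι : Fin (M + 1) → Fin m, StrictMono ι → ∀ t ∈ D, ∀ n : ℤ,
        deltaWronskian (fun (j : Fin (M + 1)) (n' : ℤ) =>
          deltaWronskian (Fin.snoc (fun i => f i t) ((fwdDiff (1 : ℤ))^[k] (f (ι j) t)) :
              Fin (m + 1) → ℤ → K) n'
            / deltaWronskian (fun i => f i t) n') n = 0] := by
  have hratio : ∀ (ι : Fin (M + 1) → Fin m) (t : ℕ+ → 𝕜),
      (fun (j : Fin (M + 1)) (n' : ℤ) =>
        deltaWronskian (Fin.snoc (fun i => f i t) ((fwdDiff (1 : ℤ))^[k] (f (ι j) t)) :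
          Fin (m + 1) → ℤ → K) n' / deltaWronskian (fun i => f i t) n')
      = fun j => (gaugeOp (fun i => f i t)).act ((fwdDiff (1 : ℤ))^[k] (f (ι j) t)) :=
    fun ι t => funext fun j => funext fun n => (gaugeOp_act _ _ n).symm
  simp only [hratio]
  have hident : ∀ (ι : Fin (M + 1) → Fin m), ∀ t ∈ D, ∀ n : ℤ,
      deltaWronskian (Fin.append (fun i => f i t)
          (fun j => (fwdDiff (1 : ℤ))^[k] (f (ι j) t))) n
        = deltaWronskian (fun i => f i t) n * deltaWronskian
          (fun j => (gaugeOp (fun i => f i t)).act ((fwdDiff (1 : ℤ))^[k] (f (ι j) t))) n :=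
    fun ι t ht n => deltaWronskian_append _ (hτ t ht) _ n
  refine ⟨isLaxSolutionOn_laxOp hD hfa hflow hτ, fun ι _ => hident ι, ?_⟩
  tfae_have 2 → 1 := fun ⟨q, r, _, _, h⟩ => ⟨q, r, h⟩
  tfae_have 1 → 4 := by
    rintro ⟨q, r, h⟩ ι - t ht n
    have heq := h t ht
    rw [minus_laxOp_pow _ (hτ t ht)] at heq
    exact deltaWronskian_eq_zero_of_sumDeltaInv_eq _ (hτ t ht) _ _ _ heq ι n
  tfae_have 4 → 3 := fun h ι hι t ht n => by rw [hident ι t ht, h ι hι t ht n, mul_zero]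
  tfae_have 3 → 2 := by
    intro h
    set R : (ℕ+ → 𝕜) → Submodule K (Fin m → K) := fun t => linearRelations K
      (fun i => (gaugeOp (fun i => f i t)).act ((fwdDiff (1 : ℤ))^[k] (f i t))) with hR
    have hfin : ∀ t ∈ D, Module.finrank K ((Fin m → K) ⧸ R t) ≤ M := by
      intro t ht
      refine finrank_quotient_linearRelations_le _ fun ι hι => ?_
      -- Only the first time is varied, since `∂ / ∂t₁` acts on the `f_i` as `Δ` itself.
      obtain ⟨ρ, hρ, hball⟩ := Metric.eventually_nhds_iff_ball.1 (hD t ht 1)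
      have := not_linearIndependent_of_deltaWronskian_append
        (F := fun i s => f i (Function.update t 1 s)) (k := k) hρ
        (fun i s hs n => (hfa i).analyticAt_update (hball s hs) n)
        (fun i s hs n => (hflow i).hasDerivAt_update (hball s hs) n)
        (hτ _ (hball _ (Metric.mem_ball_self hρ))) ι
        (fun s hs => h ι hι _ (hball s hs))
      simp only [Function.update_eq_self] at this
      exact this
    -- The factorization is chosen once per subspace, not per time, so its constants depend on `t`
    -- only through `R t` and inherit local constancy. The value `0` is a default for subspaces of
    -- too large codimension.
    have hfac : ∀ R : Submodule K (Fin m → K),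
        ∃ p : (Fin m → Fin M → K) × (Fin M → Fin m → K),
          Module.finrank K ((Fin m → K) ⧸ R) ≤ M →
            ∀ i, (fun l => (Pi.single i 1 : Fin m → K) l - ∑ j, p.1 i j * p.2 j l) ∈ R := by
      intro R
      by_cases hle : Module.finrank K ((Fin m → K) ⧸ R) ≤ M
      · obtain ⟨p, hp⟩ := exists_factorization_of_finrank_quotient_le R hle
        exact ⟨p, fun _ => hp⟩
      · exact ⟨0, fun h => absurd h hle⟩
    choose P hP using hfac
    have hloc : ∀ t ∈ D, ∀ l : ℕ+, ∀ᶠ s in 𝓝 (t l), R (Function.update t l s) = R t :=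
      fun t ht l => eventually_linearRelations_eq hD hfa hflow hτ k (fun _ => rfl) ht l
    have hσ : ∀ j : Fin M, ∀ t ∈ D, ∀ l : ℕ+, ∀ᶠ s in 𝓝 (t l),
        (P (R (Function.update t l s))).2 j = (P (R t)).2 j :=
      fun j t ht l => (hloc t ht l).mono fun s hs => by rw [hs]
    have hp : ∀ j : Fin M, ∀ t ∈ D, ∀ l : ℕ+, ∀ᶠ s in 𝓝 (t l),
        (fun i => (P (R (Function.update t l s))).1 i j) = fun i => (P (R t)).1 i j :=
      fun j t ht l => (hloc t ht l).mono fun s hs => by rw [hs]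
    refine ⟨fun j t n => ∑ i, (P (R t)).2 j i *
        (gaugeOp (fun i => f i t)).act ((fwdDiff (1 : ℤ))^[k] (f i t)) n,
      fun j t n => ∑ i, (P (R t)).1 i j * adjointBasis (fun i => f i t) i n,
      fun j => ⟨?_, ?_⟩, fun j => ⟨?_, ?_⟩, fun t ht => ?_⟩
    · exact IsTimeAnalyticOn.sum_mul Finset.univ (c := fun t => (P (R t)).2 j)
        (isTimeAnalyticOn_gaugeOp_act hfa hτ k) (hσ j)
    · exact IsEigenfunctionOn.sum_mul Finset.univ (c := fun t => (P (R t)).2 j)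
        (isEigenfunctionOn_gaugeOp_act hD hfa hflow hτ k) (hσ j)
    · exact IsTimeAnalyticOn.sum_mul Finset.univ (c := fun t i => (P (R t)).1 i j)
        (isTimeAnalyticOn_adjointBasis hfa hτ) (hp j)
    · exact IsAdjointEigenfunctionOn.sum_mul Finset.univ (c := fun t i => (P (R t)).1 i j)
        (isAdjointEigenfunctionOn_adjointBasis hD hfa hflow hτ) (hp j)
    · rw [minus_laxOp_pow _ (hτ t ht)]
      exact sumDeltaInv_eq_of_mem_linearRelations _ _ _ _ (hP (R t) (hfin t ht))
  tfae_finish
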